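/- Let $\Omega:[0,\infty)\to[0,1]$ be an admissible cone function, i.e. $\Omega(0)=1$, $\Omega(\varepsilon)<1$ for all $\varepsilon>0$, and $\Omega(\varepsilon+\varepsilon')\le\Omega(\varepsilon)\,\Omega(\varepsilon')$ for all $\varepsilon,\varepsilon'\ge 0$. Let $\delta>0$. On the cone $\mathcal C_\delta[\mathbb R]=(\mathbb R\times[0,\infty))/(\mathbb R\times\{0\})$ put $$\mathsf d([x,r],[y,s])=2\delta\sqrt{r^2+s^2-2rs\,\Omega\!\left(\tfrac{|x-y|}{2\delta}\right)},$$ and assume that $\mathsf d$ satisfies the triangle inequality, i.e. that it is a metric on the cone. A measure network is a triple $\mathcal N_X=(X,\mu_X,\omega_X)$ with $X$ a nonempty compact Polish space, $\mu_X$ a finite Borel measure on $X$, and $\omega_X:X\times X\to[0,\infty)$ bounded and measurable. A semi-coupling from $\mu_X$ to $\mu_Y$ is a pair $(\gamma_0,\gamma_1)$ of Borel measures on $X\times Y$ such that the first marginal of $\gamma_0$ is $\mu_X$ and the second marginal of $\gamma_1$ is $\mu_Y$; the set of these is $\Gamma(\mu_X,\mu_Y)$. The conic Gromov–Wasserstein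 distance is $$\mathsf{CGW}_\delta(\mathcal N_X,\mathcal N_Y)=\inf_{(\gamma_0,\gamma_1)\in\Gamma(\mu_X,\mu_Y)}\mathbf H_\delta(\gamma_0,\gamma_1)^{1/2},$$ $$\mathbf H_\delta(\gamma_0,\gamma_1)=\int_{(X\times Y)^2}\mathsf d\!\left(\left[\omega_X(x,x'),\sqrt{\tfrac{d\gamma_0}{d\gamma}(x,y)\tfrac{d\gamma_0}{d\gamma}(x',y')}\right],\left[\omega_Y(y,y'),\sqrt{\tfrac{d\gamma_1}{d\gamma}(x,y)\tfrac{d\gamma_1}{d\gamma}(x',y')}\right]\right)^{2}d\gamma(x,y)\,d\gamma(x',y'),$$ where $\gamma$ is any $\sigma$-finite measure with $\gamma_0,\gamma_1\ll\gamma$ (for instance $\gamma=\gamma_0+\gamma_1$; the value does not depend on $\gamma$). The networks $\mathcal N_X$ and $\mathcal N_Y$ are weakly isomorphic if there are a Polish space $Z$ with a Borel measure $\mu_Z$ and measurable maps $f:Z\to X$, $g:Z\to Y$ with $f_\#\mu_Z=\mu_X$, $g_\#\mu_Z=\mu_Y$ and $\omega_X(f(z),f(z'))=\omega_Y(g(z),g(z'))$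 for $\mu_Z\otimes\mu_Z$-almost every $(z,z')$. Then weak isomorphism is an equivalence relation on measure networks, and $\mathsf{CGW}_\delta$ is well defined on its equivalence classes and is a (finite) metric on them. That is, $\mathsf{CGW}_\delta$ is finite, nonnegative and symmetric, it satisfies the triangle inequality, and $\mathsf{CGW}_\delta(\mathcal N_X,\mathcal N_Y)=0$ if and only if $\mathcal N_X$ and $\mathcal N_Y$ are weakly isomorphic. -/

import Mathlib

open MeasureTheory
open scoped NNReal ENNReal

universe u

noncomputable section

namespace ConicGW

/-! ### Cones -/

/-- The relation on `X × ℝ≥0` that collapses `X × {0}` to one point. -/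
def coneSetoid (X : Type*) : Setoid (X × ℝ≥0) where
  r p q := p = q ∨ (p.2 = 0 ∧ q.2 = 0)
  iseqv :=
    { refl := fun _ => Or.inl rfl
      symm := by
        rintro p q (h | ⟨h, h'⟩)
        · exact Or.inl h.symm
        · exact Or.inr ⟨h', h⟩
      trans := by
        rintro p q r (h | ⟨h, h'⟩) (k | ⟨k, k'⟩)
        · exact Or.inl (h.trans k)
        · exact Or.inr ⟨h ▸ k, k'⟩
        · exact Or.inr ⟨h, k ▸ h'⟩
        · exact Or.inr ⟨h, k'⟩ }

/-- The cone `(X × ℝ≥0) / (X × {0})`. -/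
def Cone (X : Type*) : Type _ := Quotient (coneSetoid X)

/-- The point `[x, r]` of the cone. -/
def Cone.mk {X : Type*} (x : X) (r : ℝ≥0) : Cone X := Quotient.mk (coneSetoid X) (x, r)

/-- The axioms on a function `Ω : [0, ∞) → [0, 1]` that generates a cone distance. -/
structure IsConeFunction (Ω : ℝ≥0 → unitInterval) : Prop where
  map_zero : Ω 0 = 1
  lt_one : ∀ ε : ℝ≥0, 0 < ε → Ω ε < 1
  map_add_le : ∀ ε ε' : ℝ≥0, Ω (ε + ε') ≤ Ω ε * Ω ε'

/-- The squared cone distance `4 δ² (r² + s² - 2 r s Ω(d(x, y) / (2 δ)))` in terms of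
representatives. -/
def coneDistSq {X : Type*} [MetricSpace X] (δ : ℝ≥0) (Ω : ℝ≥0 → unitInterval)
    (p q : X × ℝ≥0) : ℝ :=
  4 * (δ : ℝ) ^ 2 * ((p.2 : ℝ) ^ 2 + (q.2 : ℝ) ^ 2
    - 2 * (p.2 : ℝ) * (q.2 : ℝ) * (Ω (nndist p.1 q.1 / (2 * δ)) : ℝ))

/-- The cone distance of angle `δ` on the cone over `X`. -/
def coneDist {X : Type*} [MetricSpace X] (δ : ℝ≥0) (Ω : ℝ≥0 → unitInterval) :
    Cone X → Cone X → ℝ :=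
  Quotient.lift₂ (s₁ := coneSetoid X) (s₂ := coneSetoid X)
    (fun p q => Real.sqrt (coneDistSq δ Ω p q)) (by
      rintro p q p' q' (h | ⟨h, h'⟩) (k | ⟨k, k'⟩)
      · rw [h, k]
      · simp [coneDistSq, h, k, k']
      · simp [coneDistSq, k, h, h']
      · simp [coneDistSq, h, h', k, k'])

theorem coneDistSq_nonneg {X : Type*} [MetricSpace X] (δ : ℝ≥0) (Ω : ℝ≥0 → unitInterval)
    (p q : X × ℝ≥0) : 0 ≤ coneDistSq δ Ω p q := by
  have h1 : (Ω (nndist p.1 q.1 / (2 * δ)) : ℝ) ≤ 1 := (Ω _).2.2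
  have h2 : (0 : ℝ) ≤ (p.2 : ℝ) * (q.2 : ℝ) := by positivity
  unfold coneDistSq
  have h3 := mul_le_mul_of_nonneg_left h1 h2
  have h4 := sq_nonneg ((p.2 : ℝ) - (q.2 : ℝ))
  apply mul_nonneg (by positivity)
  nlinarith

theorem coneDist_mk_sq {X : Type*} [MetricSpace X] (δ : ℝ≥0) (Ω : ℝ≥0 → unitInterval)
    (x y : X) (r s : ℝ≥0) :
    coneDist δ Ω (Cone.mk x r) (Cone.mk y s) ^ 2 =
      4 * (δ : ℝ) ^ 2 * ((r : ℝ) ^ 2 + (s : ℝ) ^ 2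
        - 2 * (r : ℝ) * (s : ℝ) * (Ω (nndist x y / (2 * δ)) : ℝ)) :=
  Real.sq_sqrt (coneDistSq_nonneg δ Ω (x, r) (y, s))

/-! ### Measure networks -/

/-- A measure network: a (nonempty) compact Polish space with a finite Borel measure (which is
automatically Radon) and a bounded measurable kernel with values in `[0, ∞)`. -/
structure MeasureNetwork where
  /-- the underlying space -/
  carrier : Type u
  [topology : TopologicalSpace carrier]
  [polish : PolishSpace carrier]
  [compact : CompactSpace carrier]
  [nonempty : Nonempty carrier]
  [measurableSpace : MeasurableSpace carrier]
  [borel : BorelSpace carrier]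
  /-- the measure -/
  μ : Measure carrier
  [finite : IsFiniteMeasure μ]
  /-- the kernel -/
  ω : carrier → carrier → ℝ
  nonneg : ∀ x x', 0 ≤ ω x x'
  bounded : ∃ C : ℝ, ∀ x x', ω x x' ≤ C
  measurable : Measurable (fun p : carrier × carrier => ω p.1 p.2)

attribute [instance] MeasureNetwork.topology MeasureNetwork.polish MeasureNetwork.compact
  MeasureNetwork.nonempty MeasureNetwork.measurableSpace MeasureNetwork.borel
  MeasureNetwork.finite

/-- Weak isomorphism of measure networks. The measure on `Z` is automatically finite. -/
def WeaklyIsomorphic (N M : MeasureNetwork.{u}) : Prop :=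
  ∃ (Z : Type u) (_ : TopologicalSpace Z) (_ : PolishSpace Z) (_ : MeasurableSpace Z)
    (_ : BorelSpace Z) (μZ : Measure Z) (f : Z → N.carrier) (g : Z → M.carrier),
    Measurable f ∧ Measurable g ∧ μZ.map f = N.μ ∧ μZ.map g = M.μ ∧
      eLpNorm (fun p : Z × Z => N.ω (f p.1) (f p.2) - M.ω (g p.1) (g p.2)) ∞ (μZ.prod μZ) = 0

/-! ### The conic Gromov-Wasserstein distance -/

/-- `(γ₀, γ₁)` is a semi-coupling from `μ` to `ν`: the first marginal of `γ₀` is `μ`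
and the second marginal of `γ₁` is `ν`. -/
def IsSemicoupling {X Y : Type*} [MeasurableSpace X] [MeasurableSpace Y]
    (μ : Measure X) (ν : Measure Y) (γ₀ γ₁ : Measure (X × Y)) : Prop :=
  γ₀.map Prod.fst = μ ∧ γ₁.map Prod.snd = ν

/-- The point `[w, √(dη/dγ(z) · dη/dγ(z'))]` of the cone over `ℝ`. -/
def densityPoint {E : Type*} [MeasurableSpace E] (w : ℝ) (η γ : Measure E) (z z' : E) : Cone ℝ :=
  Cone.mk w (NNReal.sqrt ((η.rnDeriv γ z).toNNReal * (η.rnDeriv γ z').toNNReal))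

/-- The conic loss of a pair of measures `γ₀, γ₁`, computed with the reference measure `γ`,
which is meant to dominate `γ₀` and `γ₁`. -/
def loss (δ : ℝ≥0) (Ω : ℝ≥0 → unitInterval) (N M : MeasureNetwork.{u})
    (γ γ₀ γ₁ : Measure (N.carrier × M.carrier)) : ℝ≥0∞ :=
  ∫⁻ q : (N.carrier × M.carrier) × (N.carrier × M.carrier),
    ENNReal.ofReal
      (coneDist δ Ω (densityPoint (N.ω q.1.1 q.2.1) γ₀ γ q.1 q.2)
        (densityPoint (M.ω q.1.2 q.2.2) γ₁ γ q.1 q.2) ^ 2) ∂(γ.prod γ)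

/-- The conic Gromov-Wasserstein distance. The reference measure in the loss is `γ₀ + γ₁`; by
`loss_eq_of_absolutelyContinuous` below, any other dominating measure gives the same value. -/
def CGW (δ : ℝ≥0) (Ω : ℝ≥0 → unitInterval) (N M : MeasureNetwork.{u}) : ℝ≥0∞ :=
  ⨅ (γ₀ : Measure (N.carrier × M.carrier)) (γ₁ : Measure (N.carrier × M.carrier))
    (_ : IsSemicoupling N.μ M.μ γ₀ γ₁), loss δ Ω N M (γ₀ + γ₁) γ₀ γ₁ ^ (1 / 2 : ℝ)

/-- The loss does not depend on the dominating reference measure. -/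
theorem loss_eq_of_absolutelyContinuous (δ : ℝ≥0) (Ω : ℝ≥0 → unitInterval)
    (N M : MeasureNetwork.{u}) (γ γ₀ γ₁ : Measure (N.carrier × M.carrier))
    [SigmaFinite γ] [IsFiniteMeasure γ₀] [IsFiniteMeasure γ₁] (h₀ : γ₀ ≪ γ) (h₁ : γ₁ ≪ γ) :
    loss δ Ω N M γ γ₀ γ₁ = loss δ Ω N M (γ₀ + γ₁) γ₀ γ₁ := by
  set σ := γ₀ + γ₁ with hσ
  have hσγ : σ ≪ γ := by
    rw [hσ]; exact Measure.AbsolutelyContinuous.add_left_iff.2 ⟨h₀, h₁⟩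
  have k0 : γ₀ ≪ σ := Measure.AbsolutelyContinuous.rfl.add_right _
  have k1 : γ₁ ≪ σ := by
    rw [hσ, add_comm]; exact Measure.AbsolutelyContinuous.rfl.add_right _
  set k := σ.rnDeriv γ with hk
  have hkm : Measurable k := Measure.measurable_rnDeriv _ _
  have hw : γ.withDensity k = σ := Measure.withDensity_rnDeriv_eq _ _ hσγ
  have e0 := Measure.rnDeriv_mul_rnDeriv (κ := γ) k0
  have e1 := Measure.rnDeriv_mul_rnDeriv (κ := γ) k1
  have ek : ∀ᵐ z ∂γ, k z < ∞ := Measure.rnDeriv_lt_top _ _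
  have hall : ∀ᵐ z ∂γ, k z < ∞ ∧ γ₀.rnDeriv γ z = γ₀.rnDeriv σ z * k z ∧
      γ₁.rnDeriv γ z = γ₁.rnDeriv σ z * k z := by
    filter_upwards [ek, e0, e1] with z a b c
    exact ⟨a, b.symm, c.symm⟩
  have l1 := Measure.quasiMeasurePreserving_fst (μ := γ) (ν := γ) |>.ae hall
  have l2 := Measure.quasiMeasurePreserving_snd (μ := γ) (ν := γ) |>.ae hall
  have hprod : σ.prod σ = (γ.prod γ).withDensity (fun q => k q.1 * k q.2) := by
    have := hw ▸ (prod_withDensity (μ := γ) (ν := γ) hkm hkm)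
    simpa [hw] using this
  unfold loss
  rw [hprod, lintegral_withDensity_eq_lintegral_mul_non_measurable₀]
  · apply lintegral_congr_ae
    filter_upwards [l1, l2] with q hq1 hq2
    obtain ⟨a1, b1, c1⟩ := hq1
    obtain ⟨a2, b2, c2⟩ := hq2
    simp only [densityPoint, coneDist_mk_sq, Pi.mul_apply]
    lift k q.1 to ℝ≥0 using a1.ne with t ht
    lift k q.2 to ℝ≥0 using a2.ne with t' ht'
    rw [b1, b2, c1, c2, ← ENNReal.coe_mul, ← ENNReal.ofReal_coe_nnreal (p := t * t'),
      ← ENNReal.ofReal_mul (by positivity)]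
    congr 1
    simp only [ENNReal.toNNReal_mul, ENNReal.toNNReal_coe, NNReal.coe_mul, Real.coe_sqrt]
    generalize ((γ₀.rnDeriv σ q.1).toNNReal : ℝ≥0) = a
    generalize ((γ₀.rnDeriv σ q.2).toNNReal : ℝ≥0) = a'
    generalize ((γ₁.rnDeriv σ q.1).toNNReal : ℝ≥0) = b
    generalize ((γ₁.rnDeriv σ q.2).toNNReal : ℝ≥0) = b'
    have r0 : √((a : ℝ) * t * (a' * t')) = √((t : ℝ) * t') * √((a : ℝ) * a') := by
      rw [← Real.sqrt_mul (by positivity)]; ring_nf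
    have r1 : √((b : ℝ) * t * (b' * t')) = √((t : ℝ) * t') * √((b : ℝ) * b') := by
      rw [← Real.sqrt_mul (by positivity)]; ring_nf
    have r2 : √((t : ℝ) * t') ^ 2 = (t : ℝ) * t' := Real.sq_sqrt (by positivity)
    rw [r0, r1]
    generalize √((t : ℝ) * t') = w at r2 ⊢
    rw [← r2]
    ring
  · exact ((hkm.comp measurable_fst).mul (hkm.comp measurable_snd)).aemeasurable
  · filter_upwards [l1, l2] with q hq1 hq2
    exact ENNReal.mul_lt_top hq1.1 hq2.1

end ConicGW

end

noncomputable section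

namespace ConicGW

/-! Expanding the squared cone distance, the radial terms integrate to the constant 4δ²(μ_X(X)² +
μ_Y(Y)²), and the cross term is -8δ² times the integral of Ω(|ω_X - ω_Y|/(2δ)) against κ ⊗ κ, where
κ = √(γ₀γ₁) is the geometric mean of the semi-coupling (`loss_add_overlap`). Minimising the loss
thus means maximising an overlap that is monotone in κ. By AM-GM, amplitudes f, g on any auxiliary
space whose squares push forward below μ_X and μ_Y yield a competitor at least as good as fg
(`CGW_sq_add_overlap_le`). Finiteness, symmetry and the vanishing on weakly isomorphic networks
follow.

For the triangle inequality, γ₁ and η₀ share the marginal μ_Y and are glued along it. On the glued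
space the three networks carry amplitudes √(dγ₀/dγ₁), 1, √(dη₁/dη₀), and Minkowski's inequality in
L² applies to the cone distance. The singular parts of γ₀ and η₁ are lost in the gluing, but they
enter the losses only through the constants, which balance (`CGW_le_add_loss`).

If the distance is zero, the minima of near-optimal γ₀ and γ₁ are sub-couplings of almost full mass
and almost no dissimilarity (`exists_subcoupling`). Normalised, they have a weak limit by
compactness. The kernels are only measurable, but they are L¹-close to continuous ones, uniformly
along the sequence because the marginals stay below multiples of μ_X and μ_Y
(`exists_probabilityMeasure_of_tendsto`). The limit is a coupling on which the kernels agree almost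
everywhere. -/

/-! ### Similarity, energy and overlap. -/

theorem IsConeFunction.antitone {Ω : ℝ≥0 → unitInterval} (hΩ : IsConeFunction Ω) :
    Antitone Ω := by
  intro a b hab
  obtain ⟨c, rfl⟩ := exists_add_of_le hab
  exact (hΩ.map_add_le a c).trans unitInterval.mul_le_left

/-- The similarity `Ω(|u - v| / (2δ))` of two real numbers. -/
def similarity (δ : ℝ≥0) (Ω : ℝ≥0 → unitInterval) (u v : ℝ) : ℝ≥0 :=
  unitInterval.toNNReal (Ω (nndist u v / (2 * δ)))

theorem coe_similarity (δ : ℝ≥0) (Ω : ℝ≥0 → unitInterval) (u v : ℝ) :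
    (similarity δ Ω u v : ℝ) = Ω (nndist u v / (2 * δ)) := rfl

theorem similarity_le_one (δ : ℝ≥0) (Ω : ℝ≥0 → unitInterval) (u v : ℝ) :
    similarity δ Ω u v ≤ 1 := (Ω _).2.2

theorem similarity_comm (δ : ℝ≥0) (Ω : ℝ≥0 → unitInterval) (u v : ℝ) :
    similarity δ Ω u v = similarity δ Ω v u := by
  rw [similarity, similarity, nndist_comm]

theorem similarity_self {δ : ℝ≥0} {Ω : ℝ≥0 → unitInterval} (hΩ : IsConeFunction Ω) (u : ℝ) :
    similarity δ Ω u u = 1 := by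
  ext; simp [coe_similarity, hΩ.map_zero]

theorem IsConeFunction.measurable_similarity {Ω : ℝ≥0 → unitInterval} (hΩ : IsConeFunction Ω)
    (δ : ℝ≥0) {T : Type*} [MeasurableSpace T] {u v : T → ℝ} (hu : Measurable u)
    (hv : Measurable v) : Measurable fun t => similarity δ Ω (u t) (v t) := by
  have h := hΩ.antitone.measurable.comp ((hu.nndist hv).div_const (2 * δ))
  exact Measurable.subtype_mk (measurable_subtype_coe.comp h)

/-- The `L²` energy between two cone-valued fields given by kernels `u, v` and amplitudes
`f, g`. -/
def energy (δ : ℝ≥0) (Ω : ℝ≥0 → unitInterval) {T : Type*} [MeasurableSpace T] (τ : Measure T)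
    (u : T × T → ℝ) (f : T → ℝ≥0) (v : T × T → ℝ) (g : T → ℝ≥0) : ℝ≥0∞ :=
  ∫⁻ t : T × T, ENNReal.ofReal (coneDist δ Ω (Cone.mk (u t) (f t.1 * f t.2))
    (Cone.mk (v t) (g t.1 * g t.2)) ^ 2) ∂(τ.prod τ)

/-- The cross term stands on the left so that the law of cosines holds in `ℝ≥0∞` without
subtraction; the integrated identities below keep this form. -/
theorem ofReal_coneDist_sq_add (δ : ℝ≥0) (Ω : ℝ≥0 → unitInterval) (u v : ℝ) (r s : ℝ≥0) :
    ENNReal.ofReal (coneDist δ Ω (Cone.mk u r) (Cone.mk v s) ^ 2) +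
      8 * (δ : ℝ≥0∞) ^ 2 * (similarity δ Ω u v * (r * s)) =
    4 * (δ : ℝ≥0∞) ^ 2 * ((r : ℝ≥0∞) ^ 2 + (s : ℝ≥0∞) ^ 2) := by
  have h : (8 * (δ : ℝ≥0∞) ^ 2 * (similarity δ Ω u v * (r * s))) =
      ENNReal.ofReal (8 * δ ^ 2 * (similarity δ Ω u v * (r * s)) : ℝ≥0) := by
    rw [ENNReal.ofReal_coe_nnreal]; push_cast; rfl
  have h' : 4 * (δ : ℝ≥0∞) ^ 2 * ((r : ℝ≥0∞) ^ 2 + (s : ℝ≥0∞) ^ 2) =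
      ENNReal.ofReal (4 * δ ^ 2 * (r ^ 2 + s ^ 2) : ℝ≥0) := by
    rw [ENNReal.ofReal_coe_nnreal]; push_cast; rfl
  rw [h, h', ← ENNReal.ofReal_add (sq_nonneg _) (NNReal.coe_nonneg _), coneDist_mk_sq]
  congr 1
  push_cast [coe_similarity]
  ring

section energy

variable {δ : ℝ≥0} {Ω : ℝ≥0 → unitInterval} {T : Type*} [MeasurableSpace T] {τ : Measure T}

theorem measurable_coneDist (hΩ : IsConeFunction Ω) {u v : T → ℝ}
    {f g : T → ℝ≥0} (hu : Measurable u) (hv : Measurable v) (hf : Measurable f)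
    (hg : Measurable g) :
    Measurable fun t => coneDist δ Ω (Cone.mk (u t) (f t)) (Cone.mk (v t) (g t)) := by
  have h := (hΩ.measurable_similarity δ hu hv).coe_nnreal_real
  have e : (fun t => coneDist δ Ω (Cone.mk (u t) (f t)) (Cone.mk (v t) (g t))) =
      fun t => √(4 * (δ : ℝ) ^ 2 * ((f t : ℝ) ^ 2 + (g t : ℝ) ^ 2
        - 2 * (f t : ℝ) * (g t : ℝ) * similarity δ Ω (u t) (v t))) := rfl
  rw [e]
  fun_prop

theorem lintegral_prod_self_mul [SFinite τ] {f : T → ℝ≥0∞} (hf : Measurable f) :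
    ∫⁻ t, f t.1 * f t.2 ∂(τ.prod τ) = (∫⁻ t, f t ∂τ) ^ 2 := by
  rw [lintegral_prod_mul hf.aemeasurable hf.aemeasurable, sq]

/-- The radii are products f(t)f(t'), so the integrals of their squares over the product space
factor into squares. -/
theorem energy_add [SFinite τ] (hΩ : IsConeFunction Ω) {u v : T × T → ℝ} {f g : T → ℝ≥0}
    (hu : Measurable u) (hv : Measurable v) (hf : Measurable f) (hg : Measurable g) :
    energy δ Ω τ u f v g +
      8 * (δ : ℝ≥0∞) ^ 2 * ∫⁻ t, similarity δ Ω (u t) (v t) *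
        ((f t.1 * g t.1 : ℝ≥0) * (f t.2 * g t.2 : ℝ≥0)) ∂(τ.prod τ) =
    4 * (δ : ℝ≥0∞) ^ 2 * ((∫⁻ t, (f t : ℝ≥0∞) ^ 2 ∂τ) ^ 2 + (∫⁻ t, (g t : ℝ≥0∞) ^ 2 ∂τ) ^ 2) := by
  have hs := hΩ.measurable_similarity δ hu hv
  rw [energy, ← lintegral_const_mul _ (by fun_prop), ← lintegral_add_right _ (by fun_prop),
    ← lintegral_prod_self_mul (by fun_prop), ← lintegral_prod_self_mul (by fun_prop),
    ← lintegral_add_right _ (by fun_prop), ← lintegral_const_mul _ (by fun_prop)]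
  refine lintegral_congr fun t => ?_
  have h := ofReal_coneDist_sq_add δ Ω (u t) (v t) (f t.1 * f t.2) (g t.1 * g t.2)
  push_cast at h ⊢
  rw [← mul_pow, ← mul_pow, ← h]
  ring

/-- Minkowski's inequality in L²(τ ⊗ τ), after the pointwise triangle inequality on the cone. -/
theorem energy_triangle (hΩ : IsConeFunction Ω)
    (hcone : ∀ p q r : Cone ℝ, coneDist δ Ω p r ≤ coneDist δ Ω p q + coneDist δ Ω q r)
    {u v w : T × T → ℝ} {f g h : T → ℝ≥0}
    (hu : Measurable u) (hv : Measurable v) (hw : Measurable w) (hf : Measurable f)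
    (hg : Measurable g) (hh : Measurable h) :
    energy δ Ω τ u f w h ^ (1 / 2 : ℝ) ≤
      energy δ Ω τ u f v g ^ (1 / 2 : ℝ) + energy δ Ω τ v g w h ^ (1 / 2 : ℝ) := by
  have key : ∀ p q : Cone ℝ, ENNReal.ofReal (coneDist δ Ω p q ^ 2) =
      ENNReal.ofReal (coneDist δ Ω p q) ^ (2 : ℝ) := by
    intro p q
    have h0 : 0 ≤ coneDist δ Ω p q := by
      induction p using Quotient.inductionOn
      induction q using Quotient.inductionOn
      exact Real.sqrt_nonneg _
    rw [ENNReal.ofReal_pow h0, ENNReal.rpow_ofNat]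
  simp only [energy, key]
  have m1 := measurable_coneDist (δ := δ) hΩ hu hv (f := fun t : T × T => f t.1 * f t.2)
    (g := fun t : T × T => g t.1 * g t.2) (by fun_prop) (by fun_prop)
  have m2 := measurable_coneDist (δ := δ) hΩ hv hw (f := fun t : T × T => g t.1 * g t.2)
    (g := fun t : T × T => h t.1 * h t.2) (by fun_prop) (by fun_prop)
  refine le_trans ?_ (ENNReal.lintegral_Lp_add_le (p := 2) m1.ennreal_ofReal.aemeasurable
    m2.ennreal_ofReal.aemeasurable (by norm_num))
  gcongr with t
  simp only [Pi.add_apply]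
  exact (ENNReal.ofReal_le_ofReal (hcone _ _ _)).trans ENNReal.ofReal_add_le

end energy

/-- The total similarity `∬ Ω(|ω_X - ω_Y| / (2δ)) dκ dκ` of two networks along `κ`. -/
def overlap (δ : ℝ≥0) (Ω : ℝ≥0 → unitInterval) (N M : MeasureNetwork.{u})
    (κ : Measure (N.carrier × M.carrier)) : ℝ≥0∞ :=
  ∫⁻ q, similarity δ Ω (N.ω q.1.1 q.2.1) (M.ω q.1.2 q.2.2) ∂(κ.prod κ)

theorem MeasureNetwork.measurable_ω_comp (N : MeasureNetwork.{u}) {T : Type*} [MeasurableSpace T]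
    {p p' : T → N.carrier} (hp : Measurable p) (hp' : Measurable p') :
    Measurable fun t => N.ω (p t) (p' t) :=
  N.measurable.comp (hp.prodMk hp')

theorem overlap_mono {δ : ℝ≥0} {Ω : ℝ≥0 → unitInterval} {N M : MeasureNetwork.{u}}
    {κ κ' : Measure (N.carrier × M.carrier)} [SFinite κ] [SFinite κ'] (h : κ ≤ κ') :
    overlap δ Ω N M κ ≤ overlap δ Ω N M κ' :=
  lintegral_mono' (Measure.prod_mono h h) le_rfl

theorem overlap_map_withDensity {δ : ℝ≥0} {Ω : ℝ≥0 → unitInterval} (hΩ : IsConeFunction Ω)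
    {N M : MeasureNetwork.{u}} {T : Type*} [MeasurableSpace T] {τ : Measure T} [SFinite τ]
    {p : T → N.carrier} {q : T → M.carrier} (hp : Measurable p) (hq : Measurable q)
    {k : T → ℝ≥0} (hk : Measurable k) :
    overlap δ Ω N M ((τ.withDensity fun t => k t).map fun t => (p t, q t)) =
      ∫⁻ t, similarity δ Ω (N.ω (p t.1) (p t.2)) (M.ω (q t.1) (q t.2)) *
        ((k t.1 : ℝ≥0∞) * k t.2) ∂(τ.prod τ) := by
  have hpq : Measurable fun t => (p t, q t) := hp.prodMk hq
  have hs : Measurable fun q : (N.carrier × M.carrier) × (N.carrier × M.carrier) =>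
      (similarity δ Ω (N.ω q.1.1 q.2.1) (M.ω q.1.2 q.2.2) : ℝ≥0∞) :=
    (hΩ.measurable_similarity δ (N.measurable_ω_comp (by fun_prop) (by fun_prop))
      (M.measurable_ω_comp (by fun_prop) (by fun_prop))).coe_nnreal_ennreal
  rw [overlap, Measure.map_prod_map _ _ hpq hpq, lintegral_map hs (hpq.prodMap hpq),
    prod_withDensity (by fun_prop) (by fun_prop),
    lintegral_withDensity_eq_lintegral_mul _ (by fun_prop) (by
      simpa only [Function.comp_def] using hs.comp (hpq.prodMap hpq))]
  refine lintegral_congr fun t => ?_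
  simp only [Pi.mul_apply, Prod.map]
  rw [mul_comm]

/-! ### Geometric means of measures. -/

/-- The square root of the density of `η` with respect to `γ`. -/
def sqrtDensity {E : Type*} [MeasurableSpace E] (η γ : Measure E) (z : E) : ℝ≥0 :=
  NNReal.sqrt (η.rnDeriv γ z).toNNReal

/-- The geometric mean `√(dγ₀/dγ · dγ₁/dγ) γ` of two measures, where `γ = γ₀ + γ₁`. -/
def geomMean {E : Type*} [MeasurableSpace E] (γ₀ γ₁ : Measure E) : Measure E :=
  (γ₀ + γ₁).withDensity fun z =>
    (sqrtDensity γ₀ (γ₀ + γ₁) z * sqrtDensity γ₁ (γ₀ + γ₁) z : ℝ≥0)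

section

variable {E : Type*} [MeasurableSpace E]

@[fun_prop]
theorem measurable_sqrtDensity (η γ : Measure E) : Measurable (sqrtDensity η γ) :=
  NNReal.continuous_sqrt.measurable.comp (Measure.measurable_rnDeriv η γ).ennreal_toNNReal

theorem coe_sqrtDensity_sq (η γ : Measure E) [SigmaFinite η] :
    (fun z => (sqrtDensity η γ z : ℝ≥0∞) ^ 2) =ᵐ[γ] η.rnDeriv γ := by
  filter_upwards [η.rnDeriv_lt_top γ] with z hz
  rw [sqrtDensity, ← ENNReal.coe_pow, NNReal.sq_sqrt, ENNReal.coe_toNNReal hz.ne]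

theorem withDensity_sqrtDensity_sq_le (η γ : Measure E) [SigmaFinite η] :
    (γ.withDensity fun z => (sqrtDensity η γ z : ℝ≥0∞) ^ 2) ≤ η := by
  rw [withDensity_congr_ae (coe_sqrtDensity_sq η γ)]
  exact Measure.withDensity_rnDeriv_le η γ

theorem withDensity_sqrtDensity_sq {η γ : Measure E} [SigmaFinite η] [SigmaFinite γ]
    (h : η ≪ γ) : (γ.withDensity fun z => (sqrtDensity η γ z : ℝ≥0∞) ^ 2) = η := by
  rw [withDensity_congr_ae (coe_sqrtDensity_sq η γ)]
  exact Measure.withDensity_rnDeriv_eq η γ h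

theorem lintegral_sqrtDensity_sq {η γ : Measure E} [SigmaFinite η] [SigmaFinite γ]
    (h : η ≪ γ) : ∫⁻ z, (sqrtDensity η γ z : ℝ≥0∞) ^ 2 ∂γ = η Set.univ := by
  rw [← setLIntegral_univ, ← withDensity_apply _ .univ, withDensity_sqrtDensity_sq h]

/-- The quadratic at² - 2kt + b is nonnegative at all rationals, hence everywhere, so its
discriminant is nonpositive. Rational weights keep the almost everywhere conditions on densities
countable. -/
theorem le_sqrt_mul_sqrt_of_forall_rat {a b k : ℝ} (ha : 0 ≤ a) (hb : 0 ≤ b) (hk : 0 ≤ k)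
    (h : ∀ q : ℚ, 0 < q → 2 * k ≤ q * a + (q : ℝ)⁻¹ * b) : k ≤ √a * √b := by
  have h1 : ∀ t : ℝ, 0 ≤ a * (t * t) + (-(2 * k)) * t + b := by
    intro t
    refine Rat.denseRange_cast.induction_on
      (p := fun t : ℝ => 0 ≤ a * (t * t) + (-(2 * k)) * t + b) t
      (isClosed_le continuous_const (by fun_prop)) fun q => ?_
    rcases le_or_gt q 0 with hq | hq
    · have hq' : (q : ℝ) ≤ 0 := by exact_mod_cast hq
      have := mul_nonneg ha (mul_self_nonneg (q : ℝ))
      nlinarith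
    · have hq' : (0 : ℝ) < q := by exact_mod_cast hq
      have := mul_le_mul_of_nonneg_left (h q hq) hq'.le
      have e : (q : ℝ) * (q * a + (q : ℝ)⁻¹ * b) = a * (q * q) + b := by field_simp
      linarith
  have h2 := discrim_le_zero h1
  rw [discrim] at h2
  rw [← Real.sqrt_mul ha]
  exact Real.le_sqrt_of_sq_le (by nlinarith)

/-- A measure lying below all the weighted arithmetic means of `γ₀` and `γ₁` lies below
their geometric mean. -/
theorem le_geomMean {κ γ₀ γ₁ : Measure E} [IsFiniteMeasure γ₀] [IsFiniteMeasure γ₁]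
    [IsFiniteMeasure κ]
    (h : ∀ t : ℝ≥0, t ≠ 0 → (2 : ℝ≥0) • κ ≤ t • γ₀ + t⁻¹ • γ₁) : κ ≤ geomMean γ₀ γ₁ := by
  set γ := γ₀ + γ₁ with hγ
  have h0 : γ₀ ≪ γ := Measure.AbsolutelyContinuous.rfl.add_right _
  have h1 : γ₁ ≪ γ := by
    rw [hγ, add_comm]; exact Measure.AbsolutelyContinuous.rfl.add_right _
  have hκ : κ ≪ γ := by
    refine Measure.AbsolutelyContinuous.mk fun s _ hs => ?_
    have h2 := h 1 one_ne_zero s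
    simp only [inv_one, one_smul, ← hγ, hs, Measure.smul_apply, nonpos_iff_eq_zero] at h2
    simpa [ENNReal.smul_def] using h2
  have e0 := Measure.withDensity_rnDeriv_eq γ₀ γ h0
  have e1 := Measure.withDensity_rnDeriv_eq γ₁ γ h1
  have e := Measure.withDensity_rnDeriv_eq κ γ hκ
  have key : ∀ q : ℚ, 0 < q → ∀ᵐ z ∂γ, 2 * κ.rnDeriv γ z ≤
      (Real.toNNReal q : ℝ≥0∞) * γ₀.rnDeriv γ z
        + ((Real.toNNReal q)⁻¹ : ℝ≥0) * γ₁.rnDeriv γ z := by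
    intro q hq
    refine ae_le_of_forall_setLIntegral_le_of_sigmaFinite (by fun_prop) fun s hs _ => ?_
    have h2 := h (Real.toNNReal q) (by simpa using hq) s
    rw [lintegral_const_mul _ (by fun_prop), lintegral_add_left (by fun_prop),
      lintegral_const_mul _ (by fun_prop), lintegral_const_mul _ (by fun_prop),
      ← withDensity_apply _ hs, ← withDensity_apply _ hs, ← withDensity_apply _ hs, e, e0, e1]
    simpa only [Measure.smul_apply, Measure.add_apply, ENNReal.smul_def, smul_eq_mul,
      ENNReal.coe_ofNat] using h2
  conv_lhs => rw [← e]
  refine withDensity_mono ?_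
  have key' : ∀ᵐ z ∂γ, ∀ q : ℚ, 0 < q → 2 * κ.rnDeriv γ z ≤
      (Real.toNNReal q : ℝ≥0∞) * γ₀.rnDeriv γ z
        + ((Real.toNNReal q)⁻¹ : ℝ≥0) * γ₁.rnDeriv γ z := by
    rw [ae_all_iff]
    intro q
    by_cases hq : 0 < q
    · filter_upwards [key q hq] with z hz _ using hz
    · exact Filter.Eventually.of_forall fun z hq' => absurd hq' hq
  filter_upwards [key', γ₀.rnDeriv_lt_top γ, γ₁.rnDeriv_lt_top γ, κ.rnDeriv_lt_top γ]
    with z hz z0 z1 zk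
  simp only [sqrtDensity, ← hγ]
  lift γ₀.rnDeriv γ z to ℝ≥0 using z0.ne with a
  lift γ₁.rnDeriv γ z to ℝ≥0 using z1.ne with b
  lift κ.rnDeriv γ z to ℝ≥0 using zk.ne with k
  rw [ENNReal.coe_le_coe, ← NNReal.coe_le_coe]
  push_cast
  refine le_sqrt_mul_sqrt_of_forall_rat a.2 b.2 k.2 fun q hq => ?_
  have h3 := hz q hq
  have h4 : 2 * k ≤ Real.toNNReal q * a + (Real.toNNReal q)⁻¹ * b := by exact_mod_cast h3
  rw [← NNReal.coe_le_coe] at h4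
  have hq' : (0 : ℝ) ≤ q := by exact_mod_cast hq.le
  simpa [hq'] using h4

theorem two_mul_mul_le (f g t : ℝ≥0) (ht : t ≠ 0) : 2 * (f * g) ≤ t * f ^ 2 + t⁻¹ * g ^ 2 := by
  have h : (0 : ℝ) < t := by positivity
  rw [← NNReal.coe_le_coe]
  push_cast
  have h1 : (t : ℝ) * f ^ 2 + (t : ℝ)⁻¹ * g ^ 2 - 2 * (f * g) = (t : ℝ)⁻¹ * (t * f - g) ^ 2 := by
    field_simp
    ring
  have h2 : 0 ≤ (t : ℝ)⁻¹ * (t * f - g) ^ 2 := by positivity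
  linarith

/-- Weighted AM-GM for densities. Being linear in the measures, these inequalities survive
push-forward, after which `le_geomMean` turns them back into a bound by a geometric mean. -/
theorem two_smul_withDensity_mul_le (τ : Measure E) {f g : E → ℝ≥0} (hf : Measurable f)
    (hg : Measurable g) {t : ℝ≥0} (ht : t ≠ 0) :
    (2 : ℝ≥0) • (τ.withDensity fun z => (f z * g z : ℝ≥0)) ≤
      t • (τ.withDensity fun z => (f z : ℝ≥0∞) ^ 2) +
        t⁻¹ • (τ.withDensity fun z => (g z : ℝ≥0∞) ^ 2) := by
  refine Measure.le_iff.2 fun s hs => ?_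
  simp only [Measure.smul_apply, Measure.add_apply, ENNReal.smul_def, smul_eq_mul]
  rw [withDensity_apply _ hs, withDensity_apply _ hs, withDensity_apply _ hs,
    ← lintegral_const_mul _ (by fun_prop), ← lintegral_const_mul _ (by fun_prop),
    ← lintegral_const_mul _ (by fun_prop), ← lintegral_add_left (by fun_prop)]
  exact lintegral_mono fun z => by
    have h := ENNReal.coe_le_coe.2 (two_mul_mul_le (f z) (g z) t ht)
    rw [ENNReal.coe_add, ENNReal.coe_mul, ENNReal.coe_mul t, ENNReal.coe_mul t⁻¹] at h
    simpa only [ENNReal.coe_pow] using h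

/-- The geometric mean of `γ₀` and `γ₁` is at most `√(dγ₀/dγ₁) γ₁`. -/
theorem geomMean_le_withDensity (γ₀ γ₁ : Measure E) [IsFiniteMeasure γ₀] [IsFiniteMeasure γ₁] :
    geomMean γ₀ γ₁ ≤ γ₁.withDensity fun z => (sqrtDensity γ₀ γ₁ z : ℝ≥0∞) := by
  set γ := γ₀ + γ₁ with hγ
  have h1 : γ₁ ≪ γ := by
    rw [hγ, add_comm]; exact Measure.AbsolutelyContinuous.rfl.add_right _
  have e1 := Measure.withDensity_rnDeriv_eq γ₁ γ h1
  have hr := Measure.rnDeriv_eq_div_rnDeriv_add γ₀ γ₁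
  rw [← hγ] at hr
  have hr' : ∀ᵐ z ∂γ, γ₁.rnDeriv γ z ≠ 0 →
      γ₀.rnDeriv γ₁ z = γ₀.rnDeriv γ z / γ₁.rnDeriv γ z := by
    rw [← ae_withDensity_iff (by fun_prop), e1]
    exact hr
  have e2 : (γ₁.withDensity fun z => (sqrtDensity γ₀ γ₁ z : ℝ≥0∞)) =
      γ.withDensity (γ₁.rnDeriv γ * fun z => (sqrtDensity γ₀ γ₁ z : ℝ≥0∞)) := by
    rw [withDensity_mul _ (by fun_prop) (by fun_prop), e1]
  rw [e2]
  refine withDensity_mono ?_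
  filter_upwards [hr', γ₀.rnDeriv_lt_top γ, γ₁.rnDeriv_lt_top γ] with z hz z0 z1
  simp only [sqrtDensity, Pi.mul_apply, ← hγ]
  by_cases hb : γ₁.rnDeriv γ z = 0
  · simp [hb]
  · rw [hz hb]
    lift γ₀.rnDeriv γ z to ℝ≥0 using z0.ne with a
    lift γ₁.rnDeriv γ z to ℝ≥0 using z1.ne with b
    rw [← ENNReal.coe_mul, ENNReal.coe_le_coe]
    have hb' : b ≠ 0 := by simpa using hb
    rw [ENNReal.toNNReal_div, ENNReal.toNNReal_coe, ENNReal.toNNReal_coe, NNReal.sqrt_div]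
    have hs : NNReal.sqrt b ≠ 0 := by simpa using hb'
    have : b * (NNReal.sqrt a / NNReal.sqrt b) = NNReal.sqrt a * NNReal.sqrt b := by
      nth_rewrite 1 [← NNReal.mul_self_sqrt b]
      field_simp
    rw [this]

end

/-! ### The loss identity, upper bounds, finiteness and symmetry. -/

theorem IsSemicoupling.isFiniteMeasure_left {X Y : Type*} [MeasurableSpace X]
    [MeasurableSpace Y] {μ : Measure X} [IsFiniteMeasure μ] {ν : Measure Y}
    {γ₀ γ₁ : Measure (X × Y)} (h : IsSemicoupling μ ν γ₀ γ₁) : IsFiniteMeasure γ₀ := by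
  refine ⟨?_⟩
  have := measure_lt_top μ Set.univ
  rwa [← h.1, Measure.map_apply measurable_fst .univ, Set.preimage_univ] at this

theorem IsSemicoupling.isFiniteMeasure_right {X Y : Type*} [MeasurableSpace X]
    [MeasurableSpace Y] {μ : Measure X} {ν : Measure Y} [IsFiniteMeasure ν]
    {γ₀ γ₁ : Measure (X × Y)} (h : IsSemicoupling μ ν γ₀ γ₁) : IsFiniteMeasure γ₁ := by
  refine ⟨?_⟩
  have := measure_lt_top ν Set.univ
  rwa [← h.2, Measure.map_apply measurable_snd .univ, Set.preimage_univ] at this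

theorem IsSemicoupling.univ_left {X Y : Type*} [MeasurableSpace X]
    [MeasurableSpace Y] {μ : Measure X} {ν : Measure Y}
    {γ₀ γ₁ : Measure (X × Y)} (h : IsSemicoupling μ ν γ₀ γ₁) : γ₀ Set.univ = μ Set.univ := by
  rw [← h.1, Measure.map_apply measurable_fst .univ, Set.preimage_univ]

theorem IsSemicoupling.univ_right {X Y : Type*} [MeasurableSpace X]
    [MeasurableSpace Y] {μ : Measure X} {ν : Measure Y}
    {γ₀ γ₁ : Measure (X × Y)} (h : IsSemicoupling μ ν γ₀ γ₁) : γ₁ Set.univ = ν Set.univ := by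
  rw [← h.2, Measure.map_apply measurable_snd .univ, Set.preimage_univ]

/-- `4δ²(μ_X(X)² + μ_Y(Y)²)`, the conic loss of two networks that share no similarity. -/
def totalLoss (δ : ℝ≥0) (N M : MeasureNetwork.{u}) : ℝ≥0∞ :=
  4 * (δ : ℝ≥0∞) ^ 2 * (N.μ Set.univ ^ 2 + M.μ Set.univ ^ 2)

theorem totalLoss_ne_top (δ : ℝ≥0) (N M : MeasureNetwork.{u}) : totalLoss δ N M ≠ ∞ := by
  unfold totalLoss
  finiteness

section loss

variable {δ : ℝ≥0} {Ω : ℝ≥0 → unitInterval} {N M : MeasureNetwork.{u}}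

theorem energy_add_overlap (hΩ : IsConeFunction Ω) {T : Type*} [MeasurableSpace T]
    {τ : Measure T} [SFinite τ] {p : T → N.carrier} {q : T → M.carrier} (hp : Measurable p)
    (hq : Measurable q) {f g : T → ℝ≥0} (hf : Measurable f) (hg : Measurable g) :
    energy δ Ω τ (fun t => N.ω (p t.1) (p t.2)) f (fun t => M.ω (q t.1) (q t.2)) g +
      8 * (δ : ℝ≥0∞) ^ 2 * overlap δ Ω N M
        ((τ.withDensity fun t => (f t * g t : ℝ≥0)).map fun t => (p t, q t)) =
    4 * (δ : ℝ≥0∞) ^ 2 * ((∫⁻ t, (f t : ℝ≥0∞) ^ 2 ∂τ) ^ 2 + (∫⁻ t, (g t : ℝ≥0∞) ^ 2 ∂τ) ^ 2) := by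
  rw [overlap_map_withDensity hΩ hp hq (by fun_prop)]
  exact energy_add hΩ (N.measurable_ω_comp (by fun_prop) (by fun_prop))
    (M.measurable_ω_comp (by fun_prop) (by fun_prop)) hf hg

theorem loss_eq_energy (γ γ₀ γ₁ : Measure (N.carrier × M.carrier)) :
    loss δ Ω N M γ γ₀ γ₁ =
      energy δ Ω γ (fun t => N.ω t.1.1 t.2.1) (sqrtDensity γ₀ γ)
        (fun t => M.ω t.1.2 t.2.2) (sqrtDensity γ₁ γ) := by
  simp only [loss, energy, densityPoint, NNReal.sqrt_mul, sqrtDensity]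

/-- The marginal conditions fix the total masses, so the semi-coupling influences its loss only
through its geometric mean. -/
theorem loss_add_overlap (hΩ : IsConeFunction Ω) {γ₀ γ₁ : Measure (N.carrier × M.carrier)}
    (h : IsSemicoupling N.μ M.μ γ₀ γ₁) :
    loss δ Ω N M (γ₀ + γ₁) γ₀ γ₁ +
      8 * (δ : ℝ≥0∞) ^ 2 * overlap δ Ω N M (geomMean γ₀ γ₁) = totalLoss δ N M := by
  have := h.isFiniteMeasure_left
  have := h.isFiniteMeasure_right
  have h0 : γ₀ ≪ γ₀ + γ₁ := Measure.AbsolutelyContinuous.rfl.add_right _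
  have h1 : γ₁ ≪ γ₀ + γ₁ := Measure.AbsolutelyContinuous.rfl.add_right' _
  have := energy_add_overlap (δ := δ) hΩ (N := N) (M := M) (τ := γ₀ + γ₁) measurable_fst
    measurable_snd (measurable_sqrtDensity γ₀ (γ₀ + γ₁)) (measurable_sqrtDensity γ₁ (γ₀ + γ₁))
  rw [lintegral_sqrtDensity_sq h0, lintegral_sqrtDensity_sq h1, h.univ_left, h.univ_right] at this
  simp only [Prod.mk.eta, Measure.map_id'] at this
  rw [loss_eq_energy]
  exact this

theorem CGW_sq_le {γ₀ γ₁ : Measure (N.carrier × M.carrier)}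
    (h : IsSemicoupling N.μ M.μ γ₀ γ₁) :
    CGW δ Ω N M ^ 2 ≤ loss δ Ω N M (γ₀ + γ₁) γ₀ γ₁ := by
  have h1 : CGW δ Ω N M ≤ loss δ Ω N M (γ₀ + γ₁) γ₀ γ₁ ^ (1 / 2 : ℝ) :=
    iInf_le_of_le γ₀ (iInf_le_of_le γ₁ (iInf_le_of_le h le_rfl))
  calc CGW δ Ω N M ^ 2 ≤ (loss δ Ω N M (γ₀ + γ₁) γ₀ γ₁ ^ (1 / 2 : ℝ)) ^ 2 := by gcongr
    _ = _ := by rw [← ENNReal.rpow_mul_natCast]; norm_num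

/-- Amplitudes on an auxiliary space whose marginals are bounded by `μ_X` and `μ_Y` give an upper
bound on the conic Gromov-Wasserstein distance. -/
theorem CGW_sq_add_overlap_le (hΩ : IsConeFunction Ω) {T : Type*} [MeasurableSpace T]
    {τ : Measure T} {p : T → N.carrier} {q : T → M.carrier} (hp : Measurable p)
    (hq : Measurable q) {f g : T → ℝ≥0} (hf : Measurable f) (hg : Measurable g)
    (h0 : (τ.withDensity fun t => (f t : ℝ≥0∞) ^ 2).map p ≤ N.μ)
    (h1 : (τ.withDensity fun t => (g t : ℝ≥0∞) ^ 2).map q ≤ M.μ) :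
    CGW δ Ω N M ^ 2 + 8 * (δ : ℝ≥0∞) ^ 2 * overlap δ Ω N M
        ((τ.withDensity fun t => (f t * g t : ℝ≥0)).map fun t => (p t, q t)) ≤
      totalLoss δ N M := by
  have hpq : Measurable fun t => (p t, q t) := hp.prodMk hq
  obtain ⟨x₀⟩ := N.nonempty
  obtain ⟨y₀⟩ := M.nonempty
  set κ := (τ.withDensity fun t => (f t * g t : ℝ≥0)).map fun t => (p t, q t) with hκ
  set α := (τ.withDensity fun t => (f t : ℝ≥0∞) ^ 2).map fun t => (p t, q t) with hα
  set β := (τ.withDensity fun t => (g t : ℝ≥0∞) ^ 2).map fun t => (p t, q t) with hβ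
  have hα0 : α.map Prod.fst ≤ N.μ := by
    rw [hα, Measure.map_map measurable_fst hpq]; exact h0
  have hβ0 : β.map Prod.snd ≤ M.μ := by
    rw [hβ, Measure.map_map measurable_snd hpq]; exact h1
  have : IsFiniteMeasure (α.map Prod.fst) := isFiniteMeasure_of_le _ hα0
  have : IsFiniteMeasure (β.map Prod.snd) := isFiniteMeasure_of_le _ hβ0
  -- The missing marginal mass is parked on the slices over y₀ and x₀. This only enlarges α and β,
  -- so the AM-GM bounds on κ persist.
  set γ₀ := α + (N.μ - α.map Prod.fst).map fun x => (x, y₀) with hγ₀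
  set γ₁ := β + (M.μ - β.map Prod.snd).map fun y => (x₀, y) with hγ₁
  have hsc : IsSemicoupling N.μ M.μ γ₀ γ₁ := by
    constructor
    · have e : ∀ m : Measure N.carrier, (m.map fun x => (x, y₀)).map Prod.fst = m := fun m => by
        rw [Measure.map_map measurable_fst (by fun_prop)]
        exact Measure.map_id
      rw [hγ₀, Measure.map_add _ _ measurable_fst, e, add_comm]
      exact Measure.sub_add_cancel_of_le hα0
    · have e : ∀ m : Measure M.carrier, (m.map fun y => (x₀, y)).map Prod.snd = m := fun m => by
        rw [Measure.map_map measurable_snd (by fun_prop)]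
        exact Measure.map_id
      rw [hγ₁, Measure.map_add _ _ measurable_snd, e, add_comm]
      exact Measure.sub_add_cancel_of_le hβ0
  have := hsc.isFiniteMeasure_left
  have := hsc.isFiniteMeasure_right
  have hα1 : α ≤ γ₀ := Measure.le_add_right le_rfl
  have hβ1 : β ≤ γ₁ := Measure.le_add_right le_rfl
  have hdom : ∀ t : ℝ≥0, t ≠ 0 → (2 : ℝ≥0) • κ ≤ t • γ₀ + t⁻¹ • γ₁ := by
    intro t ht
    have h2 := Measure.map_mono (two_smul_withDensity_mul_le τ hf hg ht) hpq
    rw [Measure.map_add _ _ hpq, Measure.map_smul, Measure.map_smul, Measure.map_smul] at h2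
    exact h2.trans (by gcongr)
  have hfin : IsFiniteMeasure κ := by
    refine ⟨?_⟩
    have h2 := hdom 1 one_ne_zero Set.univ
    have h3 : 2 * κ Set.univ < ∞ := by
      refine lt_of_le_of_lt ?_ (measure_lt_top (γ₀ + γ₁) Set.univ)
      simpa [ENNReal.smul_def] using h2
    exact lt_of_le_of_lt (by simpa using mul_le_mul_left (one_le_two (α := ℝ≥0∞)) (κ Set.univ)) h3
  have hgm : κ ≤ geomMean γ₀ γ₁ := le_geomMean hdom
  have : SFinite (geomMean γ₀ γ₁) := by unfold geomMean; infer_instance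
  rw [← loss_add_overlap hΩ hsc]
  gcongr
  · exact CGW_sq_le hsc
  · exact overlap_mono hgm

theorem exists_semicoupling_of_CGW_lt {c : ℝ≥0∞} (h : CGW δ Ω N M < c) :
    ∃ γ₀ γ₁ : Measure (N.carrier × M.carrier), IsSemicoupling N.μ M.μ γ₀ γ₁ ∧
      loss δ Ω N M (γ₀ + γ₁) γ₀ γ₁ ^ (1 / 2 : ℝ) < c := by
  simpa only [CGW, iInf_lt_iff, exists_prop] using h

theorem CGW_ne_top (hΩ : IsConeFunction Ω) : CGW δ Ω N M ≠ ∞ := by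
  -- With nothing matched, the bound is the total loss, which is finite.
  have h := CGW_sq_add_overlap_le (δ := δ) hΩ (N := N) (M := M) (τ := 0) measurable_fst
    measurable_snd (f := 0) (g := 0) measurable_zero measurable_zero (by simp [Measure.zero_le])
    (by simp [Measure.zero_le])
  have h1 := ne_top_of_le_ne_top (totalLoss_ne_top δ N M) (le_self_add.trans h)
  intro h2
  simp [h2] at h1

theorem CGW_comm_le (hΩ : IsConeFunction Ω) (N M : MeasureNetwork.{u}) :
    CGW δ Ω M N ≤ CGW δ Ω N M := by
  refine le_of_forall_gt fun c hc => ?_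
  obtain ⟨γ₀, γ₁, hsc, hl⟩ := exists_semicoupling_of_CGW_lt hc
  refine lt_of_le_of_lt ?_ hl
  have := hsc.isFiniteMeasure_left
  have := hsc.isFiniteMeasure_right
  have h0 : γ₀ ≪ γ₀ + γ₁ := Measure.AbsolutelyContinuous.rfl.add_right _
  have h1 : γ₁ ≪ γ₀ + γ₁ := Measure.AbsolutelyContinuous.rfl.add_right' _
  have hM := measurable_sqrtDensity γ₀ (γ₀ + γ₁)
  have hM' := measurable_sqrtDensity γ₁ (γ₀ + γ₁)
  have h := CGW_sq_add_overlap_le (δ := δ) hΩ (N := M) (M := N) (τ := γ₀ + γ₁) measurable_snd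
    measurable_fst hM' hM (by rw [withDensity_sqrtDensity_sq h1, hsc.2])
    (by rw [withDensity_sqrtDensity_sq h0, hsc.1])
  have h' := loss_add_overlap (δ := δ) hΩ hsc
  have e : overlap δ Ω M N (((γ₀ + γ₁).withDensity fun t =>
      (sqrtDensity γ₁ (γ₀ + γ₁) t * sqrtDensity γ₀ (γ₀ + γ₁) t : ℝ≥0)).map
        fun t => (t.2, t.1)) = overlap δ Ω N M (geomMean γ₀ γ₁) := by
    have h2 := overlap_map_withDensity (δ := δ) hΩ (N := N) (M := M) (τ := γ₀ + γ₁)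
      measurable_fst measurable_snd
      (k := fun t => sqrtDensity γ₀ (γ₀ + γ₁) t * sqrtDensity γ₁ (γ₀ + γ₁) t) (by fun_prop)
    simp only [Prod.mk.eta, Measure.map_id'] at h2
    rw [geomMean, overlap_map_withDensity hΩ measurable_snd measurable_fst (by fun_prop)]
    refine Eq.trans ?_ h2.symm
    refine lintegral_congr fun t => ?_
    rw [similarity_comm, mul_comm (sqrtDensity γ₁ _ _), mul_comm (sqrtDensity γ₁ _ _)]
  have e2 : totalLoss δ M N = totalLoss δ N M := by
    unfold totalLoss; rw [add_comm]
  rw [e, e2, ← h'] at h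
  have hfin : 8 * (δ : ℝ≥0∞) ^ 2 * overlap δ Ω N M (geomMean γ₀ γ₁) ≠ ∞ :=
    ne_top_of_le_ne_top (totalLoss_ne_top δ N M) (h' ▸ le_add_self)
  have h3 := (ENNReal.add_le_add_iff_right hfin).1 h
  calc CGW δ Ω M N = (CGW δ Ω M N ^ 2) ^ (1 / 2 : ℝ) := by
        rw [← ENNReal.rpow_natCast, ← ENNReal.rpow_mul]; norm_num
    _ ≤ _ := by gcongr

theorem CGW_comm (hΩ : IsConeFunction Ω) (N M : MeasureNetwork.{u}) :
    CGW δ Ω N M = CGW δ Ω M N :=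
  le_antisymm (CGW_comm_le hΩ M N) (CGW_comm_le hΩ N M)

end loss

/-! ### Weakly isomorphic networks are at distance zero. -/

theorem weaklyIsomorphic_iff_ae {N M : MeasureNetwork.{u}} :
    WeaklyIsomorphic N M ↔
      ∃ (Z : Type u) (_ : TopologicalSpace Z) (_ : PolishSpace Z) (_ : MeasurableSpace Z)
        (_ : BorelSpace Z) (μZ : Measure Z) (f : Z → N.carrier) (g : Z → M.carrier),
        Measurable f ∧ Measurable g ∧ μZ.map f = N.μ ∧ μZ.map g = M.μ ∧
          ∀ᵐ p ∂(μZ.prod μZ), N.ω (f p.1) (f p.2) = M.ω (g p.1) (g p.2) := by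
  have key : ∀ {Z : Type u} [MeasurableSpace Z] (μZ : Measure Z) {f : Z → N.carrier}
      {g : Z → M.carrier}, Measurable f → Measurable g →
      (eLpNorm (fun p : Z × Z => N.ω (f p.1) (f p.2) - M.ω (g p.1) (g p.2)) ∞ (μZ.prod μZ) = 0 ↔
        ∀ᵐ p ∂(μZ.prod μZ), N.ω (f p.1) (f p.2) = M.ω (g p.1) (g p.2)) := by
    intro Z _ μZ f g hf hg
    have hm : Measurable fun p : Z × Z => N.ω (f p.1) (f p.2) - M.ω (g p.1) (g p.2) :=
      (N.measurable_ω_comp (by fun_prop) (by fun_prop)).sub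
        (M.measurable_ω_comp (by fun_prop) (by fun_prop))
    rw [eLpNorm_eq_zero_iff hm.aestronglyMeasurable ENNReal.top_ne_zero]
    refine Filter.eventually_congr (Filter.Eventually.of_forall fun p => ?_)
    simp [sub_eq_zero]
  constructor
  · rintro ⟨Z, i1, i2, i3, i4, μZ, f, g, hf, hg, h1, h2, h3⟩
    exact ⟨Z, i1, i2, i3, i4, μZ, f, g, hf, hg, h1, h2, (key μZ hf hg).1 h3⟩
  · rintro ⟨Z, i1, i2, i3, i4, μZ, f, g, hf, hg, h1, h2, h3⟩
    exact ⟨Z, i1, i2, i3, i4, μZ, f, g, hf, hg, h1, h2, (key μZ hf hg).2 h3⟩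

theorem CGW_eq_zero_of_weaklyIsomorphic {δ : ℝ≥0} {Ω : ℝ≥0 → unitInterval}
    (hΩ : IsConeFunction Ω) {N M : MeasureNetwork.{u}} (h : WeaklyIsomorphic N M) :
    CGW δ Ω N M = 0 := by
  obtain ⟨Z, _, _, _, _, μZ, f, g, hf, hg, hN, hM, hae⟩ := weaklyIsomorphic_iff_ae.1 h
  have eN : μZ Set.univ = N.μ Set.univ := by
    rw [← hN, Measure.map_apply hf .univ, Set.preimage_univ]
  have eM : μZ Set.univ = M.μ Set.univ := by
    rw [← hM, Measure.map_apply hg .univ, Set.preimage_univ]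
  have : IsFiniteMeasure μZ := ⟨eN ▸ measure_lt_top N.μ _⟩
  -- With unit amplitudes on Z the similarity is 1 almost everywhere, so the overlap term uses up
  -- the whole total loss.
  have h1 := CGW_sq_add_overlap_le (δ := δ) hΩ (N := N) (M := M) (τ := μZ) hf hg
    (f := 1) (g := 1) measurable_one measurable_one (by simp [hN]) (by simp [hM])
  rw [overlap_map_withDensity hΩ hf hg (by fun_prop)] at h1
  have e : ∫⁻ t, similarity δ Ω (N.ω (f t.1) (f t.2)) (M.ω (g t.1) (g t.2)) *
      (((1 : Z → ℝ≥0) t.1 * (1 : Z → ℝ≥0) t.1 : ℝ≥0) *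
        ((1 : Z → ℝ≥0) t.2 * (1 : Z → ℝ≥0) t.2 : ℝ≥0) : ℝ≥0∞) ∂(μZ.prod μZ) =
      μZ Set.univ ^ 2 := by
    rw [sq, ← Measure.prod_prod, Set.univ_prod_univ, ← lintegral_one]
    refine lintegral_congr_ae ?_
    filter_upwards [hae] with t ht
    rw [ht, similarity_self hΩ]
    simp
  rw [e, totalLoss, ← eN, ← eM] at h1
  have hfin : 8 * (δ : ℝ≥0∞) ^ 2 * μZ Set.univ ^ 2 ≠ ∞ := by finiteness
  have e2 : 4 * (δ : ℝ≥0∞) ^ 2 * (μZ Set.univ ^ 2 + μZ Set.univ ^ 2) =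
      0 + 8 * (δ : ℝ≥0∞) ^ 2 * μZ Set.univ ^ 2 := by ring
  rw [e2, ENNReal.add_le_add_iff_right hfin] at h1
  simpa using h1

/-! ### Gluing and the triangle inequality. -/

theorem map_withDensity_comp {A B : Type*} [MeasurableSpace A] [MeasurableSpace B]
    (τ : Measure A) {φ : A → B} (hφ : Measurable φ) {k : B → ℝ≥0∞} (hk : Measurable k) :
    (τ.withDensity fun t => k (φ t)).map φ = (τ.map φ).withDensity k := by
  ext s hs
  rw [Measure.map_apply hφ hs, withDensity_apply _ (hφ hs), withDensity_apply _ hs,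
    setLIntegral_map hs hk hφ]

open ProbabilityTheory in
/-- Two measures with a common marginal can be glued along it. -/
theorem exists_gluing {X Y Z : Type*} [MeasurableSpace X] [MeasurableSpace Y] [MeasurableSpace Z]
    [StandardBorelSpace X] [StandardBorelSpace Z] [Nonempty X] [Nonempty Z]
    (γ : Measure (X × Y)) (η : Measure (Y × Z)) [IsFiniteMeasure γ] [IsFiniteMeasure η]
    (h : γ.map Prod.snd = η.map Prod.fst) :
    ∃ τ : Measure (Y × X × Z), IsFiniteMeasure τ ∧ τ.map (fun t => (t.2.1, t.1)) = γ ∧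
      τ.map (fun t => (t.1, t.2.2)) = η := by
  set γ' := γ.map Prod.swap with hγ'
  have hf : γ'.fst = η.fst := by
    rw [Measure.fst, hγ', Measure.map_map measurable_fst measurable_swap]
    exact h
  -- The X and Z coordinates are made conditionally independent given Y.
  set κ := γ'.condKernel ×ₖ η.condKernel with hκ
  refine ⟨η.fst ⊗ₘ κ, inferInstance, ?_, ?_⟩
  · have h1 : (η.fst ⊗ₘ κ).map (Prod.map id Prod.fst) = γ' := by
      rw [← Measure.compProd_map measurable_fst, ← Kernel.fst_eq, hκ, Kernel.fst_prod, ← hf,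
        Measure.disintegrate]
    have h2 : γ'.map Prod.swap = γ := by
      rw [hγ', Measure.map_map measurable_swap measurable_swap, Prod.swap_swap_eq, Measure.map_id]
    rw [← h2, ← h1, Measure.map_map measurable_swap (by fun_prop)]
    rfl
  · have h1 : (η.fst ⊗ₘ κ).map (Prod.map id Prod.snd) = η := by
      rw [← Measure.compProd_map measurable_snd, ← Kernel.snd_eq, hκ, Kernel.snd_prod,
        Measure.disintegrate]
    exact h1

theorem geomMean_comm {E : Type*} [MeasurableSpace E] (γ₀ γ₁ : Measure E) :
    geomMean γ₀ γ₁ = geomMean γ₁ γ₀ := by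
  simp only [geomMean, add_comm γ₁ γ₀, mul_comm (sqrtDensity γ₁ _ _)]

section triangle

variable {δ : ℝ≥0} {Ω : ℝ≥0 → unitInterval} {N M P : MeasureNetwork.{u}}

/-- If `k` dominates the geometric mean of a semi-coupling, then the energy of the amplitudes
of a representation of `k` is controlled by the loss. -/
theorem energy_add_le_loss_add (hΩ : IsConeFunction Ω) {γ₀ γ₁ : Measure (N.carrier × M.carrier)}
    (h : IsSemicoupling N.μ M.μ γ₀ γ₁) {T : Type*} [MeasurableSpace T] {τ : Measure T}
    [IsFiniteMeasure τ] {p : T → N.carrier} {q : T → M.carrier} (hp : Measurable p)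
    (hq : Measurable q) {f g : T → ℝ≥0} (hf : Measurable f) (hg : Measurable g)
    (hle : geomMean γ₀ γ₁ ≤ (τ.withDensity fun t => (f t * g t : ℝ≥0)).map fun t => (p t, q t)) :
    energy δ Ω τ (fun t => N.ω (p t.1) (p t.2)) f (fun t => M.ω (q t.1) (q t.2)) g +
        totalLoss δ N M ≤
      loss δ Ω N M (γ₀ + γ₁) γ₀ γ₁ + 4 * (δ : ℝ≥0∞) ^ 2 *
        ((∫⁻ t, (f t : ℝ≥0∞) ^ 2 ∂τ) ^ 2 + (∫⁻ t, (g t : ℝ≥0∞) ^ 2 ∂τ) ^ 2) := by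
  have := h.isFiniteMeasure_left
  have := h.isFiniteMeasure_right
  rw [← loss_add_overlap hΩ h, ← energy_add_overlap hΩ hp hq hf hg]
  have : SFinite (geomMean γ₀ γ₁) := by unfold geomMean; infer_instance
  have h1 := overlap_mono (δ := δ) (Ω := Ω) hle
  rw [add_left_comm]
  gcongr

theorem add_sq_sqrt (a b : ℝ≥0∞) : (a ^ (1 / 2 : ℝ) + b ^ (1 / 2 : ℝ)) ^ 2 =
    a + b + 2 * a ^ (1 / 2 : ℝ) * b ^ (1 / 2 : ℝ) := by
  have h : ∀ c : ℝ≥0∞, (c ^ (1 / 2 : ℝ)) ^ 2 = c := fun c => by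
    rw [← ENNReal.rpow_mul_natCast]; norm_num
  rw [add_sq, h, h]
  ring

/-- Write m, r for the masses of N, P and a, b for the parts of them seen on the glued space. The
energies A, B, D there satisfy A + 4δ²m² ≤ L + 4δ²a², B + 4δ²r² ≤ L' + 4δ²b² and CGW² + 4δ²(a² + b²)
≤ D + 4δ²(m² + r²). Since √D ≤ √A + √B, the constants cancel on addition. -/
theorem CGW_le_add_loss (hΩ : IsConeFunction Ω)
    (hcone : ∀ p q r : Cone ℝ, coneDist δ Ω p r ≤ coneDist δ Ω p q + coneDist δ Ω q r)
    {γ₀ γ₁ : Measure (N.carrier × M.carrier)} (hγ : IsSemicoupling N.μ M.μ γ₀ γ₁)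
    {η₀ η₁ : Measure (M.carrier × P.carrier)} (hη : IsSemicoupling M.μ P.μ η₀ η₁) :
    CGW δ Ω N P ≤ loss δ Ω N M (γ₀ + γ₁) γ₀ γ₁ ^ (1 / 2 : ℝ) +
      loss δ Ω M P (η₀ + η₁) η₀ η₁ ^ (1 / 2 : ℝ) := by
  have := hγ.isFiniteMeasure_left
  have := hγ.isFiniteMeasure_right
  have := hη.isFiniteMeasure_left
  have := hη.isFiniteMeasure_right
  have hη₀ : η₀.map Prod.fst = M.μ := hη.1
  obtain ⟨τ, hτ, hτ₁, hτ₂⟩ := exists_gluing γ₁ η₀ (hγ.2.trans hη.1.symm)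
  set L := loss δ Ω N M (γ₀ + γ₁) γ₀ γ₁
  set L' := loss δ Ω M P (η₀ + η₁) η₀ η₁
  have m₁ : Measurable fun t : M.carrier × N.carrier × P.carrier => (t.2.1, t.1) := by fun_prop
  have m₂ : Measurable fun t : M.carrier × N.carrier × P.carrier => (t.1, t.2.2) := by fun_prop
  -- The middle network gets amplitude 1, because the M-marginal of τ is its measure. Relative to γ₁
  -- and η₀, the outer amplitudes are then the square roots of the densities of γ₀ and η₁.
  set f : M.carrier × N.carrier × P.carrier → ℝ≥0 :=
    fun t => sqrtDensity γ₀ γ₁ (t.2.1, t.1)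
  set g : M.carrier × N.carrier × P.carrier → ℝ≥0 :=
    fun t => sqrtDensity η₁ η₀ (t.1, t.2.2)
  have hf : Measurable f := (measurable_sqrtDensity γ₀ γ₁).comp m₁
  have hg : Measurable g := (measurable_sqrtDensity η₁ η₀).comp m₂
  have dγ : (τ.withDensity fun t => (f t : ℝ≥0∞) ^ 2).map (fun t => (t.2.1, t.1)) ≤ γ₀ := by
    rw [map_withDensity_comp τ m₁ (k := fun z => (sqrtDensity γ₀ γ₁ z : ℝ≥0∞) ^ 2) (by fun_prop),
      hτ₁]
    exact withDensity_sqrtDensity_sq_le γ₀ γ₁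
  have dη : (τ.withDensity fun t => (g t : ℝ≥0∞) ^ 2).map (fun t => (t.1, t.2.2)) ≤ η₁ := by
    rw [map_withDensity_comp τ m₂ (k := fun z => (sqrtDensity η₁ η₀ z : ℝ≥0∞) ^ 2) (by fun_prop),
      hτ₂]
    exact withDensity_sqrtDensity_sq_le η₁ η₀
  have margN : (τ.withDensity fun t => (f t : ℝ≥0∞) ^ 2).map (fun t => t.2.1) ≤ N.μ := by
    rw [← hγ.1]
    refine le_trans (le_of_eq ?_) (Measure.map_mono dγ measurable_fst)
    rw [Measure.map_map measurable_fst m₁]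
    rfl
  have margP : (τ.withDensity fun t => (g t : ℝ≥0∞) ^ 2).map (fun t => t.2.2) ≤ P.μ := by
    rw [← hη.2]
    refine le_trans (le_of_eq ?_) (Measure.map_mono dη measurable_snd)
    rw [Measure.map_map measurable_snd m₂]
    rfl
  set a := ∫⁻ t, (f t : ℝ≥0∞) ^ 2 ∂τ with ha
  set b := ∫⁻ t, (g t : ℝ≥0∞) ^ 2 ∂τ with hb
  have haN : a ≤ N.μ Set.univ := by
    have := margN Set.univ
    rwa [Measure.map_apply (by fun_prop) .univ, Set.preimage_univ, withDensity_apply _ .univ,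
      setLIntegral_univ] at this
  have hbP : b ≤ P.μ Set.univ := by
    have := margP Set.univ
    rwa [Measure.map_apply (by fun_prop) .univ, Set.preimage_univ, withDensity_apply _ .univ,
      setLIntegral_univ] at this
  have h1 : ∫⁻ t, (((1 : M.carrier × N.carrier × P.carrier → ℝ≥0) t : ℝ≥0) : ℝ≥0∞) ^ 2 ∂τ =
      M.μ Set.univ := by
    have e : τ Set.univ = M.μ Set.univ := by
      rw [← hη.univ_left, ← hτ₂, Measure.map_apply m₂ .univ, Set.preimage_univ]
    simp [e]
  have ineqA := energy_add_le_loss_add (δ := δ) hΩ hγ (τ := τ) (p := fun t => t.2.1)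
    (q := fun t => t.1) (by fun_prop) (by fun_prop) hf (g := 1) measurable_one (by
      have := map_withDensity_comp τ m₁ (k := fun z => (sqrtDensity γ₀ γ₁ z : ℝ≥0∞))
        (by fun_prop)
      simp only [Pi.one_apply, mul_one]
      rw [this, hτ₁]
      exact geomMean_le_withDensity γ₀ γ₁)
  have ineqB := energy_add_le_loss_add (δ := δ) hΩ hη (τ := τ) (p := fun t => t.1)
    (q := fun t => t.2.2) (by fun_prop) (by fun_prop) (f := 1) measurable_one hg (by
      have := map_withDensity_comp τ m₂ (k := fun z => (sqrtDensity η₁ η₀ z : ℝ≥0∞))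
        (by fun_prop)
      simp only [Pi.one_apply, one_mul]
      rw [this, hτ₂, geomMean_comm]
      exact geomMean_le_withDensity η₁ η₀)
  have ineqC := CGW_sq_add_overlap_le (δ := δ) hΩ (N := N) (M := P) (τ := τ)
    (p := fun t => t.2.1) (q := fun t => t.2.2) (by fun_prop) (by fun_prop) hf hg margN margP
  have eqD := energy_add_overlap (δ := δ) hΩ (N := N) (M := P) (τ := τ)
    (p := fun t => t.2.1) (q := fun t => t.2.2) (by fun_prop) (by fun_prop) hf hg
  have tri := energy_triangle (δ := δ) (τ := τ) hΩ hcone (f := f) (g := 1) (h := g)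
    (u := fun t => N.ω t.1.2.1 t.2.2.1) (v := fun t => M.ω t.1.1 t.2.1)
    (w := fun t => P.ω t.1.2.2 t.2.2.2) (N.measurable_ω_comp (by fun_prop) (by fun_prop))
    (M.measurable_ω_comp (by fun_prop) (by fun_prop))
    (P.measurable_ω_comp (by fun_prop) (by fun_prop)) hf measurable_one hg
  rw [h1] at ineqA ineqB
  rw [← ha] at ineqA eqD
  rw [← hb] at ineqB eqD
  set A := energy δ Ω τ (fun t => N.ω t.1.2.1 t.2.2.1) f (fun t => M.ω t.1.1 t.2.1) 1
  set B := energy δ Ω τ (fun t => M.ω t.1.1 t.2.1) 1 (fun t => P.ω t.1.2.2 t.2.2.2) g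
  set D := energy δ Ω τ (fun t => N.ω t.1.2.1 t.2.2.1) f (fun t => P.ω t.1.2.2 t.2.2.2) g
  set O := 8 * (δ : ℝ≥0∞) ^ 2 * overlap δ Ω N P
    ((τ.withDensity fun t => (f t * g t : ℝ≥0)).map fun t => (t.2.1, t.2.2))
  unfold totalLoss at ineqA ineqB ineqC
  set m := N.μ Set.univ with hm
  set n := M.μ Set.univ with hn
  set r := P.μ Set.univ with hr
  have fm : m ≠ ∞ := measure_ne_top _ _
  have fn : n ≠ ∞ := measure_ne_top _ _
  have fr : r ≠ ∞ := measure_ne_top _ _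
  have fa : a ≠ ∞ := ne_top_of_le_ne_top fm haN
  have fb : b ≠ ∞ := ne_top_of_le_ne_top fr hbP
  have fO : O ≠ ∞ := ne_top_of_le_ne_top (by finiteness) (eqD ▸ le_add_self)
  have iA : A + 4 * (δ : ℝ≥0∞) ^ 2 * m ^ 2 ≤ L + 4 * (δ : ℝ≥0∞) ^ 2 * a ^ 2 := by
    refine (ENNReal.add_le_add_iff_right
      (show 4 * (δ : ℝ≥0∞) ^ 2 * n ^ 2 ≠ ∞ by finiteness)).1 ?_
    rw [add_assoc, add_assoc, ← mul_add, ← mul_add]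
    exact ineqA
  have iB : B + 4 * (δ : ℝ≥0∞) ^ 2 * r ^ 2 ≤ L' + 4 * (δ : ℝ≥0∞) ^ 2 * b ^ 2 := by
    refine (ENNReal.add_le_add_iff_right
      (show 4 * (δ : ℝ≥0∞) ^ 2 * n ^ 2 ≠ ∞ by finiteness)).1 ?_
    rw [add_assoc, add_assoc, ← mul_add, ← mul_add, add_comm (r ^ 2), add_comm (b ^ 2)]
    exact ineqB
  -- Since a ≤ m, the mass defect only helps. This bound is needed separately, for the mixed term
  -- 2√A√B.
  have AL : A ≤ L := by
    refine (ENNReal.add_le_add_iff_right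
      (show 4 * (δ : ℝ≥0∞) ^ 2 * a ^ 2 ≠ ∞ by finiteness)).1 (le_trans ?_ iA)
    gcongr
  have BL : B ≤ L' := by
    refine (ENNReal.add_le_add_iff_right
      (show 4 * (δ : ℝ≥0∞) ^ 2 * b ^ 2 ≠ ∞ by finiteness)).1 (le_trans ?_ iB)
    gcongr
  have iC : CGW δ Ω N P ^ 2 + 4 * (δ : ℝ≥0∞) ^ 2 * (a ^ 2 + b ^ 2) ≤
      D + 4 * (δ : ℝ≥0∞) ^ 2 * (m ^ 2 + r ^ 2) := by
    rw [← eqD, add_left_comm]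
    gcongr
  have iD : D ≤ A + B + 2 * A ^ (1 / 2 : ℝ) * B ^ (1 / 2 : ℝ) := by
    rw [← add_sq_sqrt]
    calc D = (D ^ (1 / 2 : ℝ)) ^ 2 := by rw [← ENNReal.rpow_mul_natCast]; norm_num
      _ ≤ _ := by gcongr
  have final : CGW δ Ω N P ^ 2 ≤ (L ^ (1 / 2 : ℝ) + L' ^ (1 / 2 : ℝ)) ^ 2 := by
    rw [add_sq_sqrt]
    refine (ENNReal.add_le_add_iff_right
      (show 4 * (δ : ℝ≥0∞) ^ 2 * (a ^ 2 + b ^ 2) ≠ ∞ by finiteness)).1 ?_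
    calc _ ≤ D + 4 * (δ : ℝ≥0∞) ^ 2 * (m ^ 2 + r ^ 2) := iC
      _ ≤ A + B + 2 * A ^ (1 / 2 : ℝ) * B ^ (1 / 2 : ℝ) +
          4 * (δ : ℝ≥0∞) ^ 2 * (m ^ 2 + r ^ 2) := by gcongr
      _ = (A + 4 * (δ : ℝ≥0∞) ^ 2 * m ^ 2) + (B + 4 * (δ : ℝ≥0∞) ^ 2 * r ^ 2) +
          2 * A ^ (1 / 2 : ℝ) * B ^ (1 / 2 : ℝ) := by ring
      _ ≤ (L + 4 * (δ : ℝ≥0∞) ^ 2 * a ^ 2) + (L' + 4 * (δ : ℝ≥0∞) ^ 2 * b ^ 2) +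
          2 * L ^ (1 / 2 : ℝ) * L' ^ (1 / 2 : ℝ) := by gcongr
      _ = _ := by ring
  exact (ENNReal.pow_le_pow_left_iff two_ne_zero).1 final

theorem CGW_triangle (hΩ : IsConeFunction Ω)
    (hcone : ∀ p q r : Cone ℝ, coneDist δ Ω p r ≤ coneDist δ Ω p q + coneDist δ Ω q r)
    (N M P : MeasureNetwork.{u}) : CGW δ Ω N P ≤ CGW δ Ω N M + CGW δ Ω M P := by
  refine ENNReal.le_of_forall_pos_le_add fun ε hε _ => ?_
  have hε' : ((ε / 2 : ℝ≥0) : ℝ≥0∞) ≠ 0 := by simpa using hε.ne'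
  obtain ⟨γ₀, γ₁, hγ, h1⟩ := exists_semicoupling_of_CGW_lt
    (ENNReal.lt_add_right (CGW_ne_top hΩ (δ := δ) (N := N) (M := M)) hε')
  obtain ⟨η₀, η₁, hη, h2⟩ := exists_semicoupling_of_CGW_lt
    (ENNReal.lt_add_right (CGW_ne_top hΩ (δ := δ) (N := M) (M := P)) hε')
  refine (CGW_le_add_loss hΩ hcone hγ hη).trans ((add_le_add h1.le h2.le).trans (le_of_eq ?_))
  have e : (ε : ℝ≥0∞) = ((ε / 2 : ℝ≥0) : ℝ≥0∞) + ((ε / 2 : ℝ≥0) : ℝ≥0∞) := by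
    rw [← ENNReal.coe_add, add_halves]
  rw [e]
  ring

end triangle

/-! ### Almost optimal sub-couplings at distance zero. -/

theorem sq_lintegral_mul_le {E : Type*} [MeasurableSpace E] (τ : Measure E) {f g : E → ℝ≥0}
    (hf : Measurable f) (hg : Measurable g) :
    (∫⁻ z, (f z * g z : ℝ≥0) ∂τ) ^ 2 ≤
      (∫⁻ z, (f z : ℝ≥0∞) ^ 2 ∂τ) * ∫⁻ z, (g z : ℝ≥0∞) ^ 2 ∂τ := by
  have h := ENNReal.lintegral_mul_le_Lp_mul_Lq τ Real.HolderConjugate.two_two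
    (f := fun z => (f z : ℝ≥0∞)) (g := fun z => (g z : ℝ≥0∞)) (by fun_prop) (by fun_prop)
  simp only [Pi.mul_apply, ENNReal.rpow_ofNat] at h
  simp only [ENNReal.coe_mul]
  refine (pow_le_pow_left' h 2).trans (le_of_eq ?_)
  rw [mul_pow, ← ENNReal.rpow_mul_natCast, ← ENNReal.rpow_mul_natCast]
  norm_num

section

variable {δ : ℝ≥0} {Ω : ℝ≥0 → unitInterval} {N M : MeasureNetwork.{u}}

theorem lintegral_one_sub_similarity_add_overlap (hΩ : IsConeFunction Ω)
    (κ : Measure (N.carrier × M.carrier)) [SFinite κ] :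
    ∫⁻ q, (1 - similarity δ Ω (N.ω q.1.1 q.2.1) (M.ω q.1.2 q.2.2) : ℝ≥0) ∂(κ.prod κ) +
      overlap δ Ω N M κ = κ Set.univ ^ 2 := by
  have hs := hΩ.measurable_similarity δ
    (N.measurable_ω_comp (T := (N.carrier × M.carrier) × (N.carrier × M.carrier))
      (p := fun q => q.1.1) (p' := fun q => q.2.1) (by fun_prop) (by fun_prop))
    (M.measurable_ω_comp (p := fun q => q.1.2) (p' := fun q => q.2.2) (by fun_prop) (by fun_prop))
  rw [overlap, ← lintegral_add_right _ (by fun_prop), sq, ← Measure.prod_prod,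
    Set.univ_prod_univ, ← lintegral_one]
  refine lintegral_congr fun q => ?_
  rw [← ENNReal.coe_add, tsub_add_cancel_of_le (similarity_le_one _ _ _ _), ENNReal.coe_one]

/-- Networks at distance zero admit sub-couplings with almost full mass and almost no
dissimilarity. -/
theorem exists_subcoupling (hΩ : IsConeFunction Ω) (hδ : 0 < δ) (h0 : CGW δ Ω N M = 0)
    {ε : ℝ≥0} (hε : 0 < ε) :
    ∃ κ : Measure (N.carrier × M.carrier), κ.map Prod.fst ≤ N.μ ∧ κ.map Prod.snd ≤ M.μ ∧
      (N.μ.real Set.univ - M.μ.real Set.univ) ^ 2 / 2 +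
        (N.μ.real Set.univ - κ.real Set.univ) * (M.μ.real Set.univ - κ.real Set.univ) ≤ ε ∧
      ∫⁻ q, (1 - similarity δ Ω (N.ω q.1.1 q.2.1) (M.ω q.1.2 q.2.2) : ℝ≥0) ∂(κ.prod κ) ≤ ε := by
  -- The factor 8δ² cancels the coefficient of the overlap in the loss identity.
  have hc : CGW δ Ω N M < ((8 * δ ^ 2 * ε : ℝ≥0) : ℝ≥0∞) ^ (1 / 2 : ℝ) := by
    rw [h0]
    exact ENNReal.rpow_pos (by positivity) ENNReal.coe_ne_top
  obtain ⟨γ₀, γ₁, hsc, hl⟩ := exists_semicoupling_of_CGW_lt hc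
  rw [ENNReal.rpow_lt_rpow_iff (by norm_num)] at hl
  have := hsc.isFiniteMeasure_left
  have := hsc.isFiniteMeasure_right
  have hloss := loss_add_overlap (δ := δ) hΩ hsc
  set γ := γ₀ + γ₁ with hγ
  have ac0 : γ₀ ≪ γ := Measure.AbsolutelyContinuous.rfl.add_right _
  have ac1 : γ₁ ≪ γ := Measure.AbsolutelyContinuous.rfl.add_right' _
  set f := sqrtDensity γ₀ γ
  set g := sqrtDensity γ₁ γ
  have hf : Measurable f := measurable_sqrtDensity _ _
  have hg : Measurable g := measurable_sqrtDensity _ _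
  have e0 : (γ.withDensity fun z => (f z : ℝ≥0∞) ^ 2) = γ₀ := withDensity_sqrtDensity_sq ac0
  have e1 : (γ.withDensity fun z => (g z : ℝ≥0∞) ^ 2) = γ₁ := withDensity_sqrtDensity_sq ac1
  have egm : geomMean γ₀ γ₁ = γ.withDensity fun z => (f z * g z : ℝ≥0) := rfl
  -- This is the minimum of γ₀ and γ₁. It lies below both, hence has admissible marginals, and also
  -- below their geometric mean, hence inherits a small dissimilarity.
  set κ := γ.withDensity fun z => ((min (f z) (g z) : ℝ≥0) : ℝ≥0∞) ^ 2 with hκ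
  have k0 : κ ≤ γ₀ := by
    rw [← e0]
    exact withDensity_mono (Filter.Eventually.of_forall fun z => by
      beta_reduce; gcongr; exact min_le_left _ _)
  have k1 : κ ≤ γ₁ := by
    rw [← e1]
    exact withDensity_mono (Filter.Eventually.of_forall fun z => by
      beta_reduce; gcongr; exact min_le_right _ _)
  have kg : κ ≤ geomMean γ₀ γ₁ := by
    rw [egm]
    refine withDensity_mono (Filter.Eventually.of_forall fun z => ?_)
    beta_reduce
    rw [sq, ENNReal.coe_mul]
    gcongr
    exacts [min_le_left _ _, min_le_right _ _]
  have hkfin : IsFiniteMeasure κ := isFiniteMeasure_of_le _ k0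
  have hsf : SFinite (geomMean γ₀ γ₁) := by rw [egm]; infer_instance
  have hJ := lintegral_one_sub_similarity_add_overlap (δ := δ) hΩ (geomMean γ₀ γ₁)
  have hJκ : ∫⁻ q, (1 - similarity δ Ω (N.ω q.1.1 q.2.1) (M.ω q.1.2 q.2.2) : ℝ≥0) ∂(κ.prod κ) ≤
      ∫⁻ q, (1 - similarity δ Ω (N.ω q.1.1 q.2.1) (M.ω q.1.2 q.2.2) : ℝ≥0)
        ∂((geomMean γ₀ γ₁).prod (geomMean γ₀ γ₁)) :=
    lintegral_mono' (Measure.prod_mono kg kg) le_rfl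
  have hkm : κ Set.univ ≤ N.μ Set.univ := hsc.univ_left ▸ k0 Set.univ
  have hkn : κ Set.univ ≤ M.μ Set.univ := hsc.univ_right ▸ k1 Set.univ
  set K := ∫⁻ z, ((max (f z) (g z) : ℝ≥0) : ℝ≥0∞) ^ 2 ∂γ with hK
  have hκu : κ Set.univ = ∫⁻ z, ((min (f z) (g z) : ℝ≥0) : ℝ≥0∞) ^ 2 ∂γ := by
    rw [hκ, withDensity_apply _ .univ, setLIntegral_univ]
  have hkK : κ Set.univ + K = N.μ Set.univ + M.μ Set.univ := by
    rw [hκu, hK, ← lintegral_add_left (by fun_prop), ← hsc.univ_left, ← hsc.univ_right, ← e0, ← e1,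
      withDensity_apply _ .univ, withDensity_apply _ .univ, setLIntegral_univ, setLIntegral_univ,
      ← lintegral_add_left (by fun_prop)]
    refine lintegral_congr fun z => ?_
    rcases le_total (f z) (g z) with h | h
    · rw [min_eq_left h, max_eq_right h]
    · rw [min_eq_right h, max_eq_left h, add_comm]
  -- Cauchy-Schwarz for fg = min(f, g) · max(f, g); it is what forces κ to have almost full mass.
  have hs : geomMean γ₀ γ₁ Set.univ ^ 2 ≤ κ Set.univ * K := by
    rw [egm, withDensity_apply _ .univ, setLIntegral_univ, hκu, hK]
    simp only [← min_mul_max (f _) (g _)]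
    exact sq_lintegral_mul_le γ (by fun_prop) (by fun_prop)
  refine ⟨κ, ?_, ?_, ?_, hJκ.trans ?_⟩
  · exact hsc.1 ▸ Measure.map_mono k0 measurable_fst
  · exact hsc.2 ▸ Measure.map_mono k1 measurable_snd
  -- Let m, n, k, s be the masses of N, M, κ and the geometric mean, and J its dissimilarity. The
  -- loss bound gives (m² + n²)/2 ≤ ε + s² - J with s² ≤ k(m + n - k), that is, (m - n)²/2 + (m -
  -- k)(n - k) + J ≤ ε. All terms on the left are nonnegative, so both goals follow.
  all_goals
    simp only [Measure.real, totalLoss] at *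
    generalize loss δ Ω N M γ γ₀ γ₁ = L at *
    generalize (∫⁻ q, (1 - similarity δ Ω (N.ω q.1.1 q.2.1) (M.ω q.1.2 q.2.2) : ℝ≥0)
        ∂((geomMean γ₀ γ₁).prod (geomMean γ₀ γ₁))) = J at *
    have fm : N.μ Set.univ ≠ ∞ := measure_ne_top _ _
    have fn : M.μ Set.univ ≠ ∞ := measure_ne_top _ _
    have fk : κ Set.univ ≠ ∞ := measure_ne_top _ _
    generalize N.μ Set.univ = m at *
    generalize M.μ Set.univ = n at *
    generalize κ Set.univ = k at *
    generalize geomMean γ₀ γ₁ Set.univ = s at *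
    generalize overlap δ Ω N M (geomMean γ₀ γ₁) = O at *
    have fK : K ≠ ∞ := ne_top_of_le_ne_top (by finiteness) (hkK ▸ le_add_self)
    have fL : L ≠ ∞ := hl.ne_top
    have fs : s ≠ ∞ := by
      have := ne_top_of_le_ne_top (ENNReal.mul_ne_top fk fK) hs
      simpa using this
    have fJ : J ≠ ∞ := ne_top_of_le_ne_top (by finiteness) (hJ ▸ le_self_add)
    have fO : O ≠ ∞ := ne_top_of_le_ne_top (by finiteness) (hJ ▸ le_add_self)
    clear_value K
    lift m to ℝ≥0 using fm
    lift n to ℝ≥0 using fn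
    lift k to ℝ≥0 using fk
    lift K to ℝ≥0 using fK
    lift L to ℝ≥0 using fL
    lift s to ℝ≥0 using fs
    lift J to ℝ≥0 using fJ
    lift O to ℝ≥0 using fO
    norm_cast at hloss hl hJ hkK hs hkm hkn
    rw [← NNReal.coe_le_coe] at hs hkm hkn
    rw [← NNReal.coe_lt_coe] at hl
    rw [← NNReal.coe_inj] at hloss hJ hkK
    push_cast at hloss hl hJ hkK hs
    have hδ2 : (0 : ℝ) < 4 * δ ^ 2 := by positivity
    have h1 : (m : ℝ) ^ 2 + n ^ 2 ≤ 2 * ε + 2 * O := by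
      refine le_of_mul_le_mul_left ?_ hδ2
      linarith
    have hKe : (K : ℝ) = m + n - k := by linarith
    rw [hKe] at hs
    have hJ0 : (0 : ℝ) ≤ J := J.2
    have hmk := mul_nonneg (sub_nonneg.2 hkm) (sub_nonneg.2 hkn)
  · simp only [ENNReal.coe_toReal]
    nlinarith
  · rw [ENNReal.coe_le_coe, ← NNReal.coe_le_coe]
    nlinarith [sq_nonneg ((m : ℝ) - n)]

/-- Beyond distance η the similarity is at most Ω(η/(2δ)) < 1 by monotonicity, so a multiple of the
dissimilarity covers the bound C. No continuity of Ω is involved. -/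
theorem edist_le_add_one_sub_similarity (hΩ : IsConeFunction Ω) (hδ : 0 < δ) (C : ℝ≥0)
    {η : ℝ≥0} (hη : 0 < η) : ∃ K : ℝ≥0, ∀ u v : ℝ, nndist u v ≤ C →
      edist u v ≤ η + K * (1 - similarity δ Ω u v : ℝ≥0) := by
  set a := unitInterval.toNNReal (Ω (η / (2 * δ))) with ha
  have ha1 : a < 1 := hΩ.lt_one _ (by positivity)
  refine ⟨C / (1 - a), fun u v hC => ?_⟩
  rw [edist_nndist, ← ENNReal.coe_mul, ← ENNReal.coe_add, ENNReal.coe_le_coe]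
  rcases le_total (nndist u v) η with h | h
  · exact h.trans le_self_add
  · refine hC.trans (le_trans ?_ le_add_self)
    have h1 : similarity δ Ω u v ≤ a := hΩ.antitone (by gcongr)
    calc C = C / (1 - a) * (1 - a) := (div_mul_cancel₀ _ (tsub_pos_of_lt ha1).ne').symm
      _ ≤ _ := by gcongr

end

/-! ### Weak limits of sub-couplings and the distortion. -/

open Filter Topology

theorem lintegral_prod_self_le_of_map_le {A B : Type*} [MeasurableSpace A] [MeasurableSpace B]
    {q : Measure A} [SFinite q] {μ : Measure B} [SFinite μ] {c : ℝ≥0∞} {π : A → B}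
    (hπ : Measurable π) (h : q.map π ≤ c • μ) {φ : B × B → ℝ≥0∞} (hφ : Measurable φ) :
    ∫⁻ z, φ (π z.1, π z.2) ∂(q.prod q) ≤ c * (c * ∫⁻ b, φ b ∂(μ.prod μ)) := by
  have e : ∫⁻ z, φ (π z.1, π z.2) ∂(q.prod q) = ∫⁻ b, φ b ∂((q.map π).prod (q.map π)) := by
    rw [Measure.map_prod_map _ _ hπ hπ, lintegral_map hφ (hπ.prodMap hπ)]
    rfl
  have e2 : (c • μ).prod (c • μ) = c • c • μ.prod μ := by
    rw [Measure.prod_smul_left, Measure.prod_smul_right]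
  rw [e, ← smul_eq_mul, ← smul_eq_mul, ← lintegral_smul_measure, ← lintegral_smul_measure, ← e2]
  exact lintegral_mono' (Measure.prod_mono h h) le_rfl

/-- On open sets this is the portmanteau inequality; outer regularity of the finite measure c₀μ
extends it to all sets. -/
theorem map_le_of_tendsto {A B ι : Type*} [TopologicalSpace A] [TopologicalSpace B]
    [MeasurableSpace A] [MeasurableSpace B] [BorelSpace A] [BorelSpace B] [HasOuterApproxClosed A]
    [HasOuterApproxClosed B] [PolishSpace B] {l : Filter ι} [l.NeBot] {p : ι → ProbabilityMeasure A}
    {p₀ : ProbabilityMeasure A} (hp : Tendsto p l (𝓝 p₀)) {μ : Measure B} [IsFiniteMeasure μ]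
    {c : ι → ℝ≥0} {c₀ : ℝ≥0} (hc : Tendsto c l (𝓝 c₀)) {π : A → B} (hπ : Continuous π)
    (h : ∀ i, (p i : Measure A).map π ≤ (c i : ℝ≥0∞) • μ) :
    (p₀ : Measure A).map π ≤ (c₀ : ℝ≥0∞) • μ := by
  have ht := ProbabilityMeasure.tendsto_map_of_tendsto_of_continuous p p₀ hp hπ
  have hopen : ∀ U : Set B, IsOpen U →
      (p₀ : Measure A).map π U ≤ ((c₀ : ℝ≥0∞) • μ) U := by
    intro U hU
    have h1 := ProbabilityMeasure.le_liminf_measure_open_of_tendsto ht hU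
    have h2 : Tendsto (fun i => (c i : ℝ≥0∞) * μ U) l (𝓝 ((c₀ : ℝ≥0∞) * μ U)) :=
      ENNReal.Tendsto.mul_const (ENNReal.tendsto_coe.2 hc) (Or.inr (measure_ne_top μ U))
    have h3 : l.liminf (fun i =>
        (((p i).map hπ.measurable.aemeasurable : ProbabilityMeasure B) : Measure B) U) ≤
        l.liminf fun i => (c i : ℝ≥0∞) * μ U :=
      liminf_le_liminf (Eventually.of_forall fun i => h i U)
    rw [h2.liminf_eq] at h3
    exact h1.trans h3
  have : IsFiniteMeasure ((c₀ : ℝ≥0∞) • μ) := ⟨by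
    rw [Measure.smul_apply, smul_eq_mul]
    exact ENNReal.mul_lt_top ENNReal.coe_lt_top (measure_lt_top μ _)⟩
  intro s
  rw [Set.measure_eq_iInf_isOpen s ((c₀ : ℝ≥0∞) • μ)]
  exact le_iInf fun U => le_iInf fun hs => le_iInf fun hU => (measure_mono hs).trans (hopen U hU)

theorem MeasureNetwork.exists_continuous_approx (N : MeasureNetwork.{u}) {ε : ℝ≥0∞} (hε : ε ≠ 0) :
    ∃ F : BoundedContinuousFunction (N.carrier × N.carrier) ℝ,
      ∫⁻ q, edist (N.ω q.1 q.2) (F q) ∂(N.μ.prod N.μ) ≤ ε := by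
  obtain ⟨C, hC⟩ := N.bounded
  have hmem : MemLp (fun q : N.carrier × N.carrier => N.ω q.1 q.2) 1 (N.μ.prod N.μ) :=
    MemLp.of_bound N.measurable.aestronglyMeasurable C (Eventually.of_forall fun q => by
      rw [Real.norm_of_nonneg (N.nonneg _ _)]
      exact hC _ _)
  let := TopologicalSpace.upgradeIsCompletelyMetrizable N.carrier
  obtain ⟨F, hF, -⟩ := hmem.exists_boundedContinuous_eLpNorm_sub_le ENNReal.one_ne_top hε
  refine ⟨F, ?_⟩
  rw [eLpNorm_one_eq_lintegral_enorm] at hF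
  simpa only [edist_eq_enorm_sub, Pi.sub_apply] using hF

theorem lintegral_edist_triangle4 {T : Type*} [MeasurableSpace T] (τ : Measure T)
    {a b c d : T → ℝ} (ha : Measurable a) (hb : Measurable b) (hc : Measurable c) :
    ∫⁻ t, edist (a t) (d t) ∂τ ≤
      ∫⁻ t, edist (a t) (b t) ∂τ + (∫⁻ t, edist (b t) (c t) ∂τ + ∫⁻ t, edist (c t) (d t) ∂τ) := by
  rw [← lintegral_add_left (hb.edist hc), ← lintegral_add_left (ha.edist hb)]
  refine lintegral_mono fun t => ?_
  rw [← add_assoc]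
  exact edist_triangle4 _ _ _ _

/-- The distortion `∬ |ω_X - ω_Y| dκ dκ` of a measure on the product of two networks. -/
def distortion (N M : MeasureNetwork.{u}) (κ : Measure (N.carrier × M.carrier)) : ℝ≥0∞ :=
  ∫⁻ q, edist (N.ω q.1.1 q.2.1) (M.ω q.1.2 q.2.2) ∂(κ.prod κ)

/-- Sub-couplings with vanishing distortion and converging normalisation have a limit that is a
coupling without distortion. -/
theorem exists_probabilityMeasure_of_tendsto (N M : MeasureNetwork.{u})
    (p : ℕ → ProbabilityMeasure (N.carrier × M.carrier)) (c : ℕ → ℝ≥0) {c₀ : ℝ≥0}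
    (hc : Tendsto c atTop (𝓝 c₀))
    (hN : ∀ n, (p n : Measure (N.carrier × M.carrier)).map Prod.fst ≤ (c n : ℝ≥0∞) • N.μ)
    (hM : ∀ n, (p n : Measure (N.carrier × M.carrier)).map Prod.snd ≤ (c n : ℝ≥0∞) • M.μ)
    (hd : Tendsto (fun n => distortion N M (p n)) atTop (𝓝 0)) :
    ∃ p₀ : ProbabilityMeasure (N.carrier × M.carrier),
      (p₀ : Measure (N.carrier × M.carrier)).map Prod.fst ≤ (c₀ : ℝ≥0∞) • N.μ ∧
      (p₀ : Measure (N.carrier × M.carrier)).map Prod.snd ≤ (c₀ : ℝ≥0∞) • M.μ ∧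
      distortion N M p₀ = 0 := by
  let := TopologicalSpace.upgradeIsCompletelyMetrizable N.carrier
  let := TopologicalSpace.upgradeIsCompletelyMetrizable M.carrier
  -- A limit along an ultrafilter finer than `atTop` plays the role of a convergent subsequence.
  obtain ⟨p₀, -, hp₀⟩ := (isCompact_univ
    (X := ProbabilityMeasure (N.carrier × M.carrier))).ultrafilter_le_nhds
      ((hyperfilter ℕ).map p) (by simp)
  have hp : Tendsto p (hyperfilter ℕ : Filter ℕ) (𝓝 p₀) := hp₀
  have hle : (hyperfilter ℕ : Filter ℕ) ≤ atTop := Nat.hyperfilter_le_atTop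
  have hc' := hc.mono_left hle
  have hd' := hd.mono_left hle
  have hN₀ := map_le_of_tendsto hp hc' continuous_fst hN
  have hM₀ := map_le_of_tendsto hp hc' continuous_snd hM
  refine ⟨p₀, hN₀, hM₀, ?_⟩
  have hpp : Tendsto (fun n => (p n).prod (p n)) (hyperfilter ℕ : Filter ℕ) (𝓝 (p₀.prod p₀)) :=
    (ProbabilityMeasure.continuous_prod.tendsto (p₀, p₀)).comp (hp.prodMk_nhds hp)
  -- Each of the two kernels is replaced by a continuous one twice, along the sequence and at the
  -- limit. Each replacement costs at most c²ε with c the marginal bound, which gives the factor 4.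
  have key : ∀ ε : ℝ≥0, 0 < ε → distortion N M p₀ ≤ 4 * (c₀ * (c₀ * ε)) := by
    intro ε hε
    obtain ⟨F, hF⟩ := N.exists_continuous_approx (ENNReal.coe_ne_zero.2 hε.ne')
    obtain ⟨G, hG⟩ := M.exists_continuous_approx (ENNReal.coe_ne_zero.2 hε.ne')
    have errN : ∀ (q : ProbabilityMeasure (N.carrier × M.carrier)) (k : ℝ≥0),
        (q : Measure (N.carrier × M.carrier)).map Prod.fst ≤ (k : ℝ≥0∞) • N.μ →
        ∫⁻ z, edist (N.ω z.1.1 z.2.1) (F (z.1.1, z.2.1))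
          ∂((q : Measure (N.carrier × M.carrier)).prod
            (q : Measure (N.carrier × M.carrier))) ≤ k * (k * ε) := by
      intro q k hk
      refine (lintegral_prod_self_le_of_map_le measurable_fst hk
        (φ := fun b => edist (N.ω b.1 b.2) (F b))
        (N.measurable.edist F.continuous.measurable)).trans ?_
      gcongr
    have errM : ∀ (q : ProbabilityMeasure (N.carrier × M.carrier)) (k : ℝ≥0),
        (q : Measure (N.carrier × M.carrier)).map Prod.snd ≤ (k : ℝ≥0∞) • M.μ →
        ∫⁻ z, edist (M.ω z.1.2 z.2.2) (G (z.1.2, z.2.2))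
          ∂((q : Measure (N.carrier × M.carrier)).prod
            (q : Measure (N.carrier × M.carrier))) ≤ k * (k * ε) := by
      intro q k hk
      refine (lintegral_prod_self_le_of_map_le measurable_snd hk
        (φ := fun b => edist (M.ω b.1 b.2) (G b))
        (M.measurable.edist G.continuous.measurable)).trans ?_
      gcongr
    have mN : Measurable fun z : (N.carrier × M.carrier) × (N.carrier × M.carrier) =>
        N.ω z.1.1 z.2.1 := N.measurable_ω_comp (by fun_prop) (by fun_prop)
    have mM : Measurable fun z : (N.carrier × M.carrier) × (N.carrier × M.carrier) =>
        M.ω z.1.2 z.2.2 := M.measurable_ω_comp (by fun_prop) (by fun_prop)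
    have cF : Continuous fun z : (N.carrier × M.carrier) × (N.carrier × M.carrier) =>
        F (z.1.1, z.2.1) := F.continuous.comp (by fun_prop)
    have cG : Continuous fun z : (N.carrier × M.carrier) × (N.carrier × M.carrier) =>
        G (z.1.2, z.2.2) := G.continuous.comp (by fun_prop)
    have mF := cF.measurable
    have mG := cG.measurable
    let H : BoundedContinuousFunction ((N.carrier × M.carrier) × (N.carrier × M.carrier)) ℝ≥0 :=
      BoundedContinuousFunction.mkOfCompact ⟨fun z => nndist (F (z.1.1, z.2.1)) (G (z.1.2, z.2.2)),
        cF.nndist cG⟩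
    have hH : ∀ z, (H z : ℝ≥0∞) = edist (F (z.1.1, z.2.1)) (G (z.1.2, z.2.2)) := fun z => by
      rw [edist_nndist]; rfl
    have lim := ProbabilityMeasure.tendsto_iff_forall_lintegral_tendsto.1 hpp H
    simp only [hH, ProbabilityMeasure.toMeasure_prod] at lim
    have upper : ∀ n, ∫⁻ z, edist (F (z.1.1, z.2.1)) (G (z.1.2, z.2.2))
        ∂((p n : Measure (N.carrier × M.carrier)).prod
            (p n : Measure (N.carrier × M.carrier))) ≤
        c n * (c n * ε) + (distortion N M (p n) + c n * (c n * ε)) := by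
      intro n
      have h1 := errN (p n) (c n) (hN n)
      simp only [edist_comm (N.ω _ _)] at h1
      exact (lintegral_edist_triangle4 _ mF mN mM).trans
        (add_le_add h1 (add_le_add le_rfl (errM (p n) (c n) (hM n))))
    have hcε : Tendsto (fun n => (c n : ℝ≥0∞) * (c n * ε)) (hyperfilter ℕ : Filter ℕ)
        (𝓝 (c₀ * (c₀ * ε))) := by
      have : Tendsto (fun n => c n * (c n * ε)) (hyperfilter ℕ : Filter ℕ)
          (𝓝 (c₀ * (c₀ * ε))) := hc'.mul (hc'.mul_const ε)
      exact_mod_cast ENNReal.tendsto_coe.2 this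
    have hle2 := le_of_tendsto_of_tendsto' lim (hcε.add (hd'.add hcε)) upper
    rw [zero_add] at hle2
    have h2 := errM p₀ c₀ hM₀
    simp only [edist_comm (M.ω _ _)] at h2
    calc distortion N M p₀
        ≤ c₀ * (c₀ * ε) + ((c₀ * (c₀ * ε) + c₀ * (c₀ * ε)) + c₀ * (c₀ * ε)) :=
          (lintegral_edist_triangle4 _ mN mF mG).trans
            (add_le_add (errN p₀ c₀ hN₀) (add_le_add hle2 h2))
      _ = 4 * (c₀ * (c₀ * ε)) := by ring
  refine le_antisymm (ENNReal.le_of_forall_pos_le_add fun η hη _ => ?_) zero_le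
  rw [zero_add]
  -- The summand 1 keeps the denominator positive when c₀ = 0.
  have hpos : (0 : ℝ≥0) < η / (4 * (c₀ * c₀) + 1) := by positivity
  refine (key _ hpos).trans ?_
  rw [← ENNReal.coe_mul, ← ENNReal.coe_mul, ← ENNReal.coe_ofNat, ← ENNReal.coe_mul,
    ENNReal.coe_le_coe]
  have e : 4 * (c₀ * (c₀ * (η / (4 * (c₀ * c₀) + 1)))) =
      η * ((4 * (c₀ * c₀)) / (4 * (c₀ * c₀) + 1)) := by ring
  rw [e]
  exact mul_le_of_le_one_right' (div_le_one_of_le₀ le_self_add (by positivity))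

/-! ### Distance zero implies weak isomorphism. -/

section

variable {δ : ℝ≥0} {Ω : ℝ≥0 → unitInterval} {N M : MeasureNetwork.{u}}

theorem MeasureNetwork.exists_nndist_le (N M : MeasureNetwork.{u}) :
    ∃ C : ℝ≥0, ∀ x x' y y', nndist (N.ω x x') (M.ω y y') ≤ C := by
  obtain ⟨C, hC⟩ := N.bounded
  obtain ⟨D, hD⟩ := M.bounded
  refine ⟨Real.toNNReal (max C D), fun x x' y y' => ?_⟩
  rw [← NNReal.coe_le_coe, coe_nndist, Real.dist_eq]
  refine le_trans ?_ (Real.le_coe_toNNReal _)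
  have h1 := N.nonneg x x'
  have h2 := M.nonneg y y'
  have h3 := (hC x x').trans (le_max_left C D)
  have h4 := (hD y y').trans (le_max_right C D)
  exact abs_le.2 ⟨by linarith, by linarith⟩

theorem lintegral_prod_smul_self {A : Type*} [MeasurableSpace A] (κ : Measure A) [SFinite κ]
    (c : ℝ≥0∞) (φ : A × A → ℝ≥0∞) :
    ∫⁻ q, φ q ∂((c • κ).prod (c • κ)) = c * (c * ∫⁻ q, φ q ∂(κ.prod κ)) := by
  rw [Measure.prod_smul_left, Measure.prod_smul_right, lintegral_smul_measure,
    lintegral_smul_measure, smul_eq_mul, smul_eq_mul]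

theorem measure_univ_le_of_map_le {A B : Type*} [MeasurableSpace A] [MeasurableSpace B]
    {κ : Measure A} {μ : Measure B} {π : A → B} (hπ : Measurable π) (h : κ.map π ≤ μ) :
    κ Set.univ ≤ μ Set.univ := by
  have := h Set.univ
  rwa [Measure.map_apply hπ .univ, Set.preimage_univ] at this

theorem weaklyIsomorphic_of_measure (π : Measure (N.carrier × M.carrier))
    (hN : π.map Prod.fst = N.μ) (hM : π.map Prod.snd = M.μ)
    (h : ∀ᵐ q ∂(π.prod π), N.ω q.1.1 q.2.1 = M.ω q.1.2 q.2.2) : WeaklyIsomorphic N M :=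
  weaklyIsomorphic_iff_ae.2 ⟨N.carrier × M.carrier, inferInstance, inferInstance, inferInstance,
    inferInstance, π, Prod.fst, Prod.snd, measurable_fst, measurable_snd, hN, hM, h⟩

theorem measure_univ_eq_of_CGW_eq_zero (hΩ : IsConeFunction Ω) (hδ : 0 < δ)
    (h0 : CGW δ Ω N M = 0) : N.μ Set.univ = M.μ Set.univ := by
  have h : (N.μ.real Set.univ - M.μ.real Set.univ) ^ 2 / 2 ≤ 0 := by
    refine le_of_forall_pos_le_add fun ε hε => ?_
    lift ε to ℝ≥0 using hε.le
    obtain ⟨κ, hκN, hκM, h1, -⟩ := exists_subcoupling hΩ hδ h0 (NNReal.coe_pos.1 hε)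
    have a1 : κ.real Set.univ ≤ N.μ.real Set.univ :=
      ENNReal.toReal_mono (measure_ne_top _ _) (measure_univ_le_of_map_le measurable_fst hκN)
    have a2 : κ.real Set.univ ≤ M.μ.real Set.univ :=
      ENNReal.toReal_mono (measure_ne_top _ _) (measure_univ_le_of_map_le measurable_snd hκM)
    have := mul_nonneg (sub_nonneg.2 a1) (sub_nonneg.2 a2)
    linarith
  have h2 : N.μ.real Set.univ - M.μ.real Set.univ = 0 := by
    have := sq_nonneg (N.μ.real Set.univ - M.μ.real Set.univ)
    exact pow_eq_zero_iff two_ne_zero |>.1 (by linarith)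
  exact (ENNReal.toReal_eq_toReal_iff' (measure_ne_top _ _) (measure_ne_top _ _)).1
    (sub_eq_zero.1 h2)

theorem weaklyIsomorphic_of_CGW_eq_zero (hΩ : IsConeFunction Ω) (hδ : 0 < δ)
    (h0 : CGW δ Ω N M = 0) : WeaklyIsomorphic N M := by
  have hmass := measure_univ_eq_of_CGW_eq_zero hΩ hδ h0
  by_cases hz : N.μ Set.univ = 0
  · have hN : N.μ = 0 := Measure.measure_univ_eq_zero.1 hz
    have hM : M.μ = 0 := Measure.measure_univ_eq_zero.1 (hmass ▸ hz)
    exact weaklyIsomorphic_of_measure 0 (by simp [hN]) (by simp [hM]) (by simp)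
  obtain ⟨m, hm⟩ : ∃ m : ℝ≥0, (m : ℝ≥0∞) = N.μ Set.univ :=
    ⟨_, ENNReal.coe_toNNReal (measure_ne_top _ _)⟩
  have hmM : (m : ℝ≥0∞) = M.μ Set.univ := hm.trans hmass
  have hmpos : 0 < m := by
    rw [pos_iff_ne_zero]
    rintro rfl
    exact hz (by simpa using hm.symm)
  have hmpos' : (0 : ℝ) < m := hmpos
  -- With equal masses m, the mass estimate reads (m - k)² ≤ ε. The bound ε ≤ (m/2)² then rules out
  -- k = 0, so every κ can be normalised.
  set ε : ℕ → ℝ≥0 := fun i => (m / 2) ^ 2 / (i + 1) with hε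
  have hεpos : ∀ i, 0 < ε i := fun i => by positivity
  have hεlim : Tendsto ε atTop (𝓝 0) := by
    rw [← NNReal.tendsto_coe]
    have := (tendsto_one_div_add_atTop_nhds_zero_nat (𝕜 := ℝ)).const_mul (((m : ℝ) / 2) ^ 2)
    rw [mul_zero] at this
    refine this.congr fun i => ?_
    simp only [hε]
    push_cast
    ring
  choose κ hκN hκM hκm hκd using fun i => exists_subcoupling hΩ hδ h0 (hεpos i)
  have hκle : ∀ i, κ i Set.univ ≤ m := fun i =>
    (measure_univ_le_of_map_le measurable_fst (hκN i)).trans hm.ge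
  have hκfin : ∀ i, IsFiniteMeasure (κ i) := fun i => ⟨(hκle i).trans_lt ENNReal.coe_lt_top⟩
  choose k hk using fun i => (⟨_, ENNReal.coe_toNNReal (measure_ne_top (κ i) Set.univ)⟩ :
    ∃ k : ℝ≥0, (k : ℝ≥0∞) = κ i Set.univ)
  have hsq : ∀ i, ((m : ℝ) - k i) ^ 2 ≤ ε i := by
    intro i
    have := hκm i
    simp only [Measure.real, ← hm, ← hmM, ← hk, ENNReal.coe_toReal, sub_self] at this
    nlinarith
  have hkpos : ∀ i, k i ≠ 0 := by
    intro i hki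
    have h1 := hsq i
    have h2 : (ε i : ℝ) ≤ (m / 2) ^ 2 := by
      simp only [hε]
      push_cast
      exact div_le_self (by positivity) (by linarith [(Nat.cast_nonneg i : (0 : ℝ) ≤ i)])
    rw [hki, NNReal.coe_zero] at h1
    nlinarith
  have hklim : Tendsto k atTop (𝓝 m) := by
    rw [← NNReal.tendsto_coe, tendsto_iff_dist_tendsto_zero]
    have h1 : Tendsto (fun i => √(ε i : ℝ)) atTop (𝓝 0) := by
      have := (Real.continuous_sqrt.tendsto 0).comp (NNReal.tendsto_coe.2 hεlim)
      rwa [Real.sqrt_zero] at this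
    refine squeeze_zero (fun _ => dist_nonneg) (fun i => ?_) h1
    rw [dist_comm, Real.dist_eq]
    exact Real.abs_le_sqrt (hsq i)
  have hclim : Tendsto (fun i => (k i)⁻¹) atTop (𝓝 m⁻¹) := hklim.inv₀ hmpos.ne'
  set c : ℕ → ℝ≥0 := fun i => (k i)⁻¹ with hc
  have hprob : ∀ i, IsProbabilityMeasure ((c i : ℝ≥0∞) • κ i) := fun i => ⟨by
    rw [Measure.smul_apply, smul_eq_mul, ← hk, ← ENNReal.coe_mul, inv_mul_cancel₀ (hkpos i),
      ENNReal.coe_one]⟩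
  let p : ℕ → ProbabilityMeasure (N.carrier × M.carrier) :=
    fun i => ⟨(c i : ℝ≥0∞) • κ i, hprob i⟩
  have hp : ∀ i, (p i : Measure (N.carrier × M.carrier)) = (c i : ℝ≥0∞) • κ i := fun i => rfl
  obtain ⟨C, hC⟩ := N.exists_nndist_le M
  have hd : Tendsto (fun i => distortion N M (p i)) atTop (𝓝 0) := by
    rw [ENNReal.tendsto_nhds_zero]
    intro e he
    obtain ⟨η, hη, hηe⟩ : ∃ η : ℝ≥0, 0 < η ∧ (η : ℝ≥0∞) + η ≤ e := by
      obtain ⟨r, hr, hre⟩ := ENNReal.lt_iff_exists_nnreal_btwn.1 he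
      refine ⟨r / 2, half_pos (by simpa using hr), ?_⟩
      rw [← ENNReal.coe_add, add_halves]
      exact hre.le
    -- K is fixed by η before the index grows, so the dissimilarity term K c² ε eventually falls
    -- below η.
    obtain ⟨K, hK⟩ := edist_le_add_one_sub_similarity (δ := δ) hΩ hδ C hη
    have hlim : Tendsto (fun i => K * (c i * (c i * ε i))) atTop (𝓝 0) := by
      have := ((hclim.mul (hclim.mul hεlim)).const_mul K)
      simpa using this
    filter_upwards [hlim.eventually_le_const hη] with i hi
    refine le_trans ?_ hηe
    have hs := hΩ.measurable_similarity δ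
      (N.measurable_ω_comp (T := (N.carrier × M.carrier) × (N.carrier × M.carrier))
        (p := fun q => q.1.1) (p' := fun q => q.2.1) (by fun_prop) (by fun_prop))
      (M.measurable_ω_comp (p := fun q => q.1.2) (p' := fun q => q.2.2) (by fun_prop)
        (by fun_prop))
    calc distortion N M (p i)
        ≤ ∫⁻ q, ((η : ℝ≥0∞) +
            K * (1 - similarity δ Ω (N.ω q.1.1 q.2.1) (M.ω q.1.2 q.2.2) : ℝ≥0))
            ∂((p i : Measure (N.carrier × M.carrier)).prod
              (p i : Measure (N.carrier × M.carrier))) :=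
          lintegral_mono fun q => hK _ _ (hC _ _ _ _)
      _ = η + K * (c i * (c i * ∫⁻ q,
            (1 - similarity δ Ω (N.ω q.1.1 q.2.1) (M.ω q.1.2 q.2.2) : ℝ≥0)
            ∂((κ i).prod (κ i)))) := by
          rw [lintegral_add_left (by fun_prop), lintegral_const, measure_univ, mul_one,
            lintegral_const_mul _ (by fun_prop), hp, lintegral_prod_smul_self]
      _ ≤ η + K * (c i * (c i * ε i)) := by
          gcongr
          exact hκd i
      _ ≤ η + η := by
          gcongr
          exact_mod_cast hi
  have hmap : ∀ {B : Type u} [MeasurableSpace B] {μ : Measure B} {π : N.carrier × M.carrier → B},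
      (∀ i, (κ i).map π ≤ μ) → ∀ i, (p i : Measure (N.carrier × M.carrier)).map π ≤
        (c i : ℝ≥0∞) • μ := by
    intro B _ μ π h i
    rw [hp, Measure.map_smul]
    gcongr
    exact h i
  obtain ⟨p₀, hN, hM, hD⟩ := exists_probabilityMeasure_of_tendsto N M p c hclim (hmap hκN)
    (hmap hκM) hd
  have hm1 : (m : ℝ≥0∞) * ((m⁻¹ : ℝ≥0) : ℝ≥0∞) = 1 := by
    rw [← ENNReal.coe_mul, mul_inv_cancel₀ hmpos.ne', ENNReal.coe_one]
  -- Both sides of the marginal inequality are probability measures, so it is an equality.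
  have heq : ∀ {B : Type u} [MeasurableSpace B] {μ : Measure B} {π : N.carrier × M.carrier → B},
      Measurable π → (m : ℝ≥0∞) = μ Set.univ →
      (p₀ : Measure (N.carrier × M.carrier)).map π ≤ ((m⁻¹ : ℝ≥0) : ℝ≥0∞) • μ →
      ((m : ℝ≥0∞) • (p₀ : Measure (N.carrier × M.carrier))).map π = μ := by
    intro B _ μ π hπ hμ h
    have i1 : IsProbabilityMeasure ((p₀ : Measure (N.carrier × M.carrier)).map π) :=
      Measure.isProbabilityMeasure_map hπ.aemeasurable
    have i2 : IsProbabilityMeasure (((m⁻¹ : ℝ≥0) : ℝ≥0∞) • μ) := ⟨by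
      rw [Measure.smul_apply, smul_eq_mul, ← hμ, mul_comm, hm1]⟩
    rw [Measure.map_smul, Measure.eq_of_le_of_isProbabilityMeasure h, smul_smul, hm1, one_smul]
  refine weaklyIsomorphic_of_measure ((m : ℝ≥0∞) • (p₀ : Measure (N.carrier × M.carrier)))
    (heq measurable_fst hm hN) (heq measurable_snd hmM hM) ?_
  rw [Measure.prod_smul_left, Measure.prod_smul_right]
  refine Measure.ae_smul_measure (Measure.ae_smul_measure ?_ _) _
  have hmeas : Measurable fun q : (N.carrier × M.carrier) × (N.carrier × M.carrier) =>
      edist (N.ω q.1.1 q.2.1) (M.ω q.1.2 q.2.2) :=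
    (N.measurable_ω_comp (by fun_prop) (by fun_prop)).edist
      (M.measurable_ω_comp (by fun_prop) (by fun_prop))
  rw [distortion, lintegral_eq_zero_iff hmeas] at hD
  filter_upwards [hD] with q hq
  exact edist_eq_zero.1 hq

/-! ### The metric on weak isomorphism classes. -/

theorem CGW_eq_zero_iff (hΩ : IsConeFunction Ω) (hδ : 0 < δ) :
    CGW δ Ω N M = 0 ↔ WeaklyIsomorphic N M :=
  ⟨weaklyIsomorphic_of_CGW_eq_zero hΩ hδ, CGW_eq_zero_of_weaklyIsomorphic hΩ⟩

theorem weaklyIsomorphic_refl (N : MeasureNetwork.{u}) : WeaklyIsomorphic N N :=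
  weaklyIsomorphic_iff_ae.2 ⟨N.carrier, inferInstance, inferInstance, inferInstance,
    inferInstance, N.μ, id, id, measurable_id, measurable_id, Measure.map_id, Measure.map_id,
    Eventually.of_forall fun _ => rfl⟩

/-- Symmetry and transitivity are read off from the distance through its zero set, which avoids
gluing the spaces Z directly. -/
theorem weaklyIsomorphic_equivalence (hΩ : IsConeFunction Ω) (hδ : 0 < δ)
    (hcone : ∀ p q r : Cone ℝ, coneDist δ Ω p r ≤ coneDist δ Ω p q + coneDist δ Ω q r) :
    Equivalence WeaklyIsomorphic.{u} where
  refl := weaklyIsomorphic_refl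
  symm {N M} h := by
    rw [← CGW_eq_zero_iff hΩ hδ] at h ⊢
    rw [CGW_comm hΩ, h]
  trans {N M P} h h' := by
    rw [← CGW_eq_zero_iff hΩ hδ] at h h' ⊢
    have := CGW_triangle hΩ hcone N M P
    rw [h, h', add_zero] at this
    exact le_antisymm this zero_le

theorem CGW_congr (hΩ : IsConeFunction Ω)
    (hcone : ∀ p q r : Cone ℝ, coneDist δ Ω p r ≤ coneDist δ Ω p q + coneDist δ Ω q r)
    {N' M' : MeasureNetwork.{u}} (hN : CGW δ Ω N N' = 0) (hM : CGW δ Ω M M' = 0) :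
    CGW δ Ω N M = CGW δ Ω N' M' := by
  refine le_antisymm ?_ ?_
  · calc CGW δ Ω N M ≤ CGW δ Ω N N' + (CGW δ Ω N' M' + CGW δ Ω M' M) :=
        (CGW_triangle hΩ hcone N N' M).trans (add_le_add le_rfl (CGW_triangle hΩ hcone N' M' M))
      _ = CGW δ Ω N' M' := by rw [hN, CGW_comm hΩ M', hM, zero_add, add_zero]
  · calc CGW δ Ω N' M' ≤ CGW δ Ω N' N + (CGW δ Ω N M + CGW δ Ω M M') :=
        (CGW_triangle hΩ hcone N' N M').trans (add_le_add le_rfl (CGW_triangle hΩ hcone N M M'))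
      _ = CGW δ Ω N M := by rw [CGW_comm hΩ N', hN, hM, zero_add, add_zero]

end

end ConicGW

end

theorem theorem3p3 (δ : ℝ≥0) (hδ : 0 < δ) (Ω : ℝ≥0 → unitInterval)
    (hΩ : ConicGW.IsConeFunction Ω)
    (hcone : ∀ p q r : ConicGW.Cone ℝ,
      ConicGW.coneDist δ Ω p r ≤ ConicGW.coneDist δ Ω p q + ConicGW.coneDist δ Ω q r) :
    ∃ (hE : Equivalence ConicGW.WeaklyIsomorphic.{u})
      (m : MetricSpace (Quotient
        (⟨ConicGW.WeaklyIsomorphic, hE⟩ : Setoid ConicGW.MeasureNetwork.{u}))),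
      ∀ N M : ConicGW.MeasureNetwork.{u},
        m.edist (Quotient.mk _ N) (Quotient.mk _ M) = ConicGW.CGW δ Ω N M := by
  have hE := ConicGW.weaklyIsomorphic_equivalence.{u} hΩ hδ hcone
  refine ⟨hE, ?_⟩
  let S : Setoid ConicGW.MeasureNetwork.{u} := ⟨ConicGW.WeaklyIsomorphic, hE⟩
  let e : EMetricSpace (Quotient S) :=
    { edist := Quotient.lift₂ (ConicGW.CGW δ Ω) fun N M N' M' hN hM =>
        ConicGW.CGW_congr hΩ hcone ((ConicGW.CGW_eq_zero_iff hΩ hδ).2 hN)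
          ((ConicGW.CGW_eq_zero_iff hΩ hδ).2 hM)
      edist_self := fun a => by
        induction a using Quotient.inductionOn with | _ N =>
        exact (ConicGW.CGW_eq_zero_iff hΩ hδ).2 (hE.refl N)
      edist_comm := fun a b => by
        induction a, b using Quotient.inductionOn₂ with | _ N M =>
        exact ConicGW.CGW_comm hΩ N M
      edist_triangle := fun a b c => by
        induction a, b, c using Quotient.inductionOn₃ with | _ N M P =>
        exact ConicGW.CGW_triangle hΩ hcone N M P
      eq_of_edist_eq_zero := fun {a b} => by
        induction a, b using Quotient.inductionOn₂ with | _ N M =>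
        exact fun h => Quotient.sound ((ConicGW.CGW_eq_zero_iff hΩ hδ).1 h) }
  have hfin : ∀ a b : Quotient S, edist a b ≠ ∞ := fun a b => by
    induction a, b using Quotient.inductionOn₂ with | _ N M =>
    exact ConicGW.CGW_ne_top hΩ
  exact ⟨EMetricSpace.toMetricSpace hfin, fun N M => rfl⟩
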